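/- **Setting.** Let $h\colon\mathbb{N}\to[1,\infty)$ be a function with $h(n)\to\infty$ as $n\to\infty$. For $n\ge 2$ let $\mathcal{P}_n$ be the set of primes $p$ with $\lceil n/2\rceil+1\le p\le n$. For a prime $p$, a vector $z\in\{1,\dots,p-1\}^d$ and $f\colon[0,1]^d\to\mathbb{C}$ let $$Q_p^z(f)=\frac1p\sum_{k=0}^{p-1} f\Big(\Big\{\frac{kz}{p}\Big\}\Big),$$ where $\{\cdot\}$ is the entrywise fractional part. Put $N=2\lceil h(n)\log_2 n\rceil+1$. Choose independent pairs $(p_k,z_k)$, $1\le k\le N$, where $p_k$ is uniform on $\mathcal{P}_n$ and, given $p_k$, $z_k$ is uniform on $\{1,\dots,p_k-1\}^d$, and put $$M_n^{(p_k,z_k)_k}(f)=\operatorname{median}\{Q_{p_k}^{z_k}(f) : 1\le k\le N\},$$ where the median of complex numbers is taken separately for the real and imaginary parts. For $\alpha>1/2$ and $\gamma=(\gamma_1,\gamma_2,\dots)\in(0,1]^{\mathbb{N}}$ let $r(k)=\prod_{j:\,k_j\ne0}\gamma_j^{-1}|k_j|^{\alpha}$ for $k\in\mathbb{Z}^d$.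 The weighted Korobov class $\mathcal{H}_{d,\alpha,\gamma}$ consists of all $f\colon[0,1]^d\to\mathbb{C}$ that are everywhere the sum of their absolutely convergent Fourier series and for which $\|f\|_{d,\alpha,\gamma}^2=\sum_{k\in\mathbb{Z}^d} r(k)^2|\hat f(k)|^2$ is finite. With $I_d(f)=\int_{[0,1]^d}f(x)\,dx$, the worst-case error of a deterministic method $A$ and the randomized error of a random method $(A^\omega)_\omega$ are $$e^{\rm det}_{d,\alpha,\gamma}(A)=\sup_{\|f\|_{d,\alpha,\gamma}\le1}|I_d(f)-A(f)|,\qquad e^{\rm ran}_{d,\alpha,\gamma}(A)=\sup_{\|f\|_{d,\alpha,\gamma}\le1}\mathbb{E}_\omega|I_d(f)-A^\omega(f)|.$$ **Theorem 1.** For all $\alpha>1/2$, $\gamma\in(0,1]^{\mathbb{N}}$, $\varepsilon>0$ and all dimensions $d$ there are a constant $C=C(\alpha,\varepsilon,\gamma,d)>0$, not depending on $h$, and a positive integer $n_0=n_0(\alpha,\varepsilon,\gamma,d)$, which may also depend on $h$, such that: (i) for all $n\ge n_0$, $\;e^{\rm ran}_{d,\alpha,\gamma}\big(M_n^{(p_k,z_k)_k}\big)\le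 C\,n^{-\alpha-1/2+\varepsilon}$; (ii) for all $n\ge2$, with probability at least $1-n^{-h(n)}$ over the choice of $(p_k,z_k)_k$, $\;e^{\rm det}_{d,\alpha,\gamma}\big(M_n^{(p_k,z_k)_k}\big)\le C\,n^{-\alpha+\varepsilon}$. If $\gamma\in\ell_{1/\alpha}$, that is, $\sum_{j}\gamma_j^{1/\alpha}<\infty$, then $C$ and $n_0$ can be chosen independently of $d$. -/

import Mathlib

open scoped ENNReal

noncomputable section

namespace MedianLattice

/-! ### Weighted Korobov classes -/

/-- The integral of `f` over the unit cube `[0,1]^d`. -/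
def cubeIntegral {d : ℕ} (f : (Fin d → ℝ) → ℂ) : ℂ :=
  ∫ x in Set.Icc (0 : Fin d → ℝ) 1, f x

/-- The exponential `x ↦ exp (2 π i k · x)` of frequency `k ∈ ℤ^d`. -/
def expo {d : ℕ} (k : Fin d → ℤ) (x : Fin d → ℝ) : ℂ :=
  Complex.exp (2 * Real.pi * Complex.I * ∑ j, (k j : ℂ) * (x j : ℂ))

/-- The `k`-th Fourier coefficient of `f : [0,1]^d → ℂ`. -/
def fourierCoef {d : ℕ} (f : (Fin d → ℝ) → ℂ) (k : Fin d → ℤ) : ℂ :=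
  cubeIntegral fun x => f x * expo (-k) x

/-- The support of a frequency vector. -/
def supp {d : ℕ} (k : Fin d → ℤ) : Finset (Fin d) :=
  Finset.univ.filter fun j => k j ≠ 0

/-- The function `r_{d,α,γ}` for the product weights generated by the sequence `γ`
(the weight of coordinate `j`, counted from `0`, is `γ j`). -/
def rWeight {d : ℕ} (α : ℝ) (γ : ℕ → ℝ) (k : Fin d → ℤ) : ℝ :=
  (∏ j ∈ supp k, γ j)⁻¹ * ∏ j ∈ supp k, |(k j : ℝ)| ^ α

/-- Membership in the weighted Korobov class: `f` is, at every point of the cube `[0,1]^d`, the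
sum of its absolutely convergent Fourier series, and its Korobov norm is finite.
(Values of `f` outside the cube play no role.) -/
def MemKorobov {d : ℕ} (α : ℝ) (γ : ℕ → ℝ) (f : (Fin d → ℝ) → ℂ) : Prop :=
  (Summable fun k : Fin d → ℤ => ‖fourierCoef f k‖) ∧
  (∀ x ∈ Set.Icc (0 : Fin d → ℝ) 1, HasSum (fun k => fourierCoef f k * expo k x) (f x)) ∧
  Summable fun k : Fin d → ℤ => rWeight α γ k ^ 2 * ‖fourierCoef f k‖ ^ 2

/-- The norm of the weighted Korobov class. -/
def korobovNorm {d : ℕ} (α : ℝ) (γ : ℕ → ℝ) (f : (Fin d → ℝ) → ℂ) : ℝ :=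
  Real.sqrt (∑' k : Fin d → ℤ, rWeight α γ k ^ 2 * ‖fourierCoef f k‖ ^ 2)

/-- The unit ball of the weighted Korobov class. -/
def korobovBall (d : ℕ) (α : ℝ) (γ : ℕ → ℝ) : Set ((Fin d → ℝ) → ℂ) :=
  {f | MemKorobov α γ f ∧ korobovNorm α γ f ≤ 1}

/-! ### Errors -/

/-- The worst-case error of a deterministic method `A` on the Korobov class. -/
def detError {d : ℕ} (α : ℝ) (γ : ℕ → ℝ) (A : ((Fin d → ℝ) → ℂ) → ℂ) : ℝ≥0∞ :=
  ⨆ f ∈ korobovBall d α γ, ‖cubeIntegral f - A f‖ₑ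

/-- The randomized error on the Korobov class of a random method `A`, where `P` is the law of the
random parameter `ω`. -/
def ranError {d : ℕ} {Ω : Type*} [MeasurableSpace Ω] (P : MeasureTheory.Measure Ω)
    (α : ℝ) (γ : ℕ → ℝ) (A : Ω → ((Fin d → ℝ) → ℂ) → ℂ) : ℝ≥0∞ :=
  ⨆ f ∈ korobovBall d α γ, ∫⁻ ω, ‖cubeIntegral f - A ω f‖ₑ ∂P

/-! ### The algorithm -/

/-- The lattice rule with `p` points and generating vector `z`. -/
def latticeRule {d : ℕ} (p : ℕ) (z : Fin d → ℕ) (f : (Fin d → ℝ) → ℂ) : ℂ :=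
  (1 / (p : ℂ)) * ∑ k ∈ Finset.range p, f fun j => Int.fract ((k : ℝ) * (z j : ℝ) / (p : ℝ))

/-- The median of an odd number of real numbers: the middle entry of the sorted tuple. -/
def realMedian {m : ℕ} (x : Fin (2 * m + 1) → ℝ) : ℝ :=
  x (Tuple.sort x ⟨m, by omega⟩)

/-- The median of an odd number of complex numbers, taken separately in the real and imaginary
parts. -/
def complexMedian {m : ℕ} (x : Fin (2 * m + 1) → ℂ) : ℂ :=
  ⟨realMedian fun i => (x i).re, realMedian fun i => (x i).im⟩

/-- The primes between `⌈n/2⌉ + 1` and `n`. -/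
def primesUpTo (n : ℕ) : Finset ℕ :=
  (Finset.Icc (⌈(n : ℝ) / 2⌉₊ + 1) n).filter Nat.Prime

/-- The set `{1, …, p-1}^d` of generating vectors. -/
def genVectors (d p : ℕ) : Finset (Fin d → ℕ) :=
  Fintype.piFinset fun _ => Finset.Icc 1 (p - 1)

/-- The law of one random pair `(p, z)`: `p` is uniform on `primesUpTo n` and, given `p`, the
vector `z` is uniform on `{1, …, p-1}^d`. -/
def drawLaw (d n : ℕ) : MeasureTheory.Measure (ℕ × (Fin d → ℕ)) :=
  (ProbabilityTheory.uniformOn (primesUpTo n : Set ℕ)).bind fun p =>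
    (ProbabilityTheory.uniformOn (genVectors d p : Set (Fin d → ℕ))).map (Prod.mk p)

/-- The number `⌈h(n) log₂ n⌉`; the algorithm uses `2 * halfReps h n + 1` repetitions. -/
def halfReps (h : ℕ → ℝ) (n : ℕ) : ℕ := ⌈h n * Real.logb 2 n⌉₊

/-- The joint law of the independent pairs `(p_k, z_k)` used by the algorithm. -/
def sampleLaw (h : ℕ → ℝ) (d n : ℕ) :
    MeasureTheory.Measure (Fin (2 * halfReps h n + 1) → ℕ × (Fin d → ℕ)) :=
  MeasureTheory.Measure.pi fun _ => drawLaw d n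

/-- The output of the algorithm for the realization `ω = (p_k, z_k)_k`. -/
def medianRule {d m : ℕ} (ω : Fin (2 * m + 1) → ℕ × (Fin d → ℕ)) (f : (Fin d → ℝ) → ℂ) : ℂ :=
  complexMedian fun i => latticeRule (ω i).1 (ω i).2 f

/-- The bound on the randomized error for a given number `n`. -/
def RanBound (h : ℕ → ℝ) (d : ℕ) (α : ℝ) (γ : ℕ → ℝ) (ε C : ℝ) (n : ℕ) : Prop :=
  ranError (sampleLaw h d n) α γ (fun ω => medianRule ω) ≤
    ENNReal.ofReal (C * (n : ℝ) ^ (-α - 1 / 2 + ε))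

/-- The bound, with high probability, on the worst-case error for a given number `n`. -/
def DetBound (h : ℕ → ℝ) (d : ℕ) (α : ℝ) (γ : ℕ → ℝ) (ε C : ℝ) (n : ℕ) : Prop :=
  1 - (n : ℝ) ^ (-h n) ≤
    (sampleLaw h d n).real
      {ω | detError α γ (medianRule ω) ≤ ENNReal.ofReal (C * (n : ℝ) ^ (-α + ε))}

end MedianLattice

end

/-! Write `r` for the weight `rWeight`. The error of a lattice rule at `f` is at most the sum of
`|f̂(k)|` over the nonzero dual lattice `p ∣ k · z`. A fixed `k ≠ 0` lies in the random dual lattice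
with probability at most `q r(k)^δ`, where `q` is of order `n^(-(1-δ))`: only `O(log |k_j|)` of the
at least `c n^(1-δ)` available primes divide a nonzero entry `k_j`, and for any other prime `z_j` is
determined by the remaining coordinates (`exists_drawLaw_mem_dualSet_le`).

Let `S` bound `∑ r^(-a)` with `a` slightly above `1/α`, and put `s = a + δ`. By Markov, outside
probability `1/16` the sum of `r^(-s)` over the dual lattice is at most `T = 16 q S`. On such a good
draw every dual frequency has `r ≥ T^(-1/s)`, and Cauchy–Schwarz bounds the error by `T^(1/s)`,
about `n^(-α)`, for all `f` at once.

For a fixed `f` one may instead average over the draw: the frequencies with `r ≥ T^(-1/s)` have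
expected contribution at most `q` times a Cauchy–Schwarz square root. The probability `q` now stands
outside the root instead of inside, which gains `n^(-1/2)` (`measure_lt_enorm_sub_latticeRule_le`).

The median is bad only if more than half of the repetitions are, which has probability at most
`2^(-m) ≤ n^(-h(n))`. For (i) this failure costs at most a constant times `n^(-h(n))`, negligible
once `h(n) ≥ α + 1/2`. -/

noncomputable section

namespace MedianLattice

open MeasureTheory ProbabilityTheory

/-! ### Primes between `n / 2` and `n` -/

/-- The primes in `(m, 2 m]`. -/
def bertrandPrimes (m : ℕ) : Finset ℕ :=
  (Finset.Ioc m (2 * m)).filter Nat.Prime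

/-- Erdős's argument for Bertrand's postulate, with the primes in `(m, 2m]` kept. Prime powers in
the binomial are at most `2m`; primes in `(√(2m), 2m/3]` occur at most once, so the primorial bounds
them; primes in `(2m/3, m]` do not occur. -/
theorem centralBinom_le_mul_pow_card (m : ℕ) (hm : 2 < m) :
    m.centralBinom ≤ (2 * m) ^ Nat.sqrt (2 * m) * 4 ^ (2 * m / 3) *
      (2 * m) ^ (bertrandPrimes m).card := by
  have m_pos : 0 < m := by omega
  have m2_pos : 1 ≤ 2 * m := by omega
  set f : ℕ → ℕ := fun x => x ^ m.centralBinom.factorization x with hf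
  have hsplit : m.centralBinom =
      (∏ p ∈ Finset.range (2 * m / 3 + 1), f p) * ∏ p ∈ Finset.Ico (2 * m / 3 + 1) (2 * m + 1), f p := by
    rw [Finset.prod_range_mul_prod_Ico f (by omega : 2 * m / 3 + 1 ≤ 2 * m + 1)]
    exact m.prod_pow_factorization_centralBinom.symm
  rw [hsplit]
  apply mul_le_mul'
  · have : ∏ x ∈ (Finset.range (2 * m / 3 + 1)).filter Nat.Prime, f x =
        ∏ x ∈ Finset.range (2 * m / 3 + 1), f x := by
      refine Finset.prod_filter_of_ne fun p _ h => ?_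
      contrapose h; dsimp only [f]
      rw [Nat.factorization_eq_zero_of_not_prime m.centralBinom h, _root_.pow_zero]
    rw [← this, ← Finset.prod_filter_mul_prod_filter_not _ (· ≤ Nat.sqrt (2 * m))]
    apply mul_le_mul'
    · refine (Finset.prod_le_prod' fun p _ => (?_ : f p ≤ 2 * m)).trans ?_
      · exact Nat.pow_factorization_choose_le (mul_pos two_pos m_pos)
      have : (Finset.Icc 1 (Nat.sqrt (2 * m))).card = Nat.sqrt (2 * m) := by
        rw [Nat.card_Icc, Nat.add_sub_cancel]
      rw [Finset.prod_const]
      refine pow_right_mono₀ m2_pos ((Finset.card_le_card fun x hx => ?_).trans this.le)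
      obtain ⟨h1, h2⟩ := Finset.mem_filter.1 hx
      exact Finset.mem_Icc.mpr ⟨(Finset.mem_filter.1 h1).2.one_lt.le, h2⟩
    · refine le_trans ?_ (primorial_le_four_pow (2 * m / 3))
      refine (Finset.prod_le_prod' fun p hp => (?_ : f p ≤ p)).trans ?_
      · obtain ⟨h1, h2⟩ := Finset.mem_filter.1 hp
        refine (pow_right_mono₀ (Finset.mem_filter.1 h1).2.one_lt.le ?_).trans (pow_one p).le
        exact Nat.factorization_choose_le_one (Nat.sqrt_lt'.mp <| not_le.1 h2)
      refine Finset.prod_le_prod_of_subset_of_one_le' (Finset.filter_subset _ _) ?_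
      exact fun p hp _ => (Finset.mem_filter.1 hp).2.one_lt.le
  · have : ∏ p ∈ bertrandPrimes m, f p =
        ∏ p ∈ Finset.Ico (2 * m / 3 + 1) (2 * m + 1), f p := by
      apply Finset.prod_subset
      · intro p hp
        simp only [bertrandPrimes, Finset.mem_filter, Finset.mem_Ioc, Finset.mem_Ico] at hp ⊢
        omega
      · intro p hp hp'
        simp only [bertrandPrimes, Finset.mem_filter, Finset.mem_Ioc, Finset.mem_Ico] at hp hp'
        dsimp only [f]
        by_cases hpp : p.Prime
        · rw [Nat.factorization_centralBinom_of_two_mul_self_lt_three_mul hm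
            (by by_contra; apply hp'; exact ⟨by omega, hpp⟩) (by omega), pow_zero]
        · rw [Nat.factorization_eq_zero_of_not_prime _ hpp, pow_zero]
    rw [← this]
    refine (Finset.prod_le_prod' fun p _ => (?_ : f p ≤ 2 * m)).trans ?_
    · exact Nat.pow_factorization_choose_le (mul_pos two_pos m_pos)
    rw [Finset.prod_const]

/-- The main term is `m log 4` minus the primorial's `(2m/3) log 4`. -/
theorem log_le_card_bertrandPrimes_mul_log (m : ℕ) (hm : 4 ≤ m) :
    Real.log 4 / 6 * (2 * m : ℝ) - Real.log (2 * m) - √(2 * m) * Real.log (2 * m) ≤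
      (bertrandPrimes m).card * Real.log (2 * m) := by
  have h1 : 4 ^ m ≤ m * ((2 * m) ^ Nat.sqrt (2 * m) * 4 ^ (2 * m / 3) *
      (2 * m) ^ (bertrandPrimes m).card) :=
    (Nat.four_pow_lt_mul_centralBinom m hm).le.trans
      (Nat.mul_le_mul_left _ (centralBinom_le_mul_pow_card m (by omega)))
  have hm0 : (0 : ℝ) < m := by positivity
  have h2 : (4 : ℝ) ^ m ≤ m * ((2 * m) ^ Nat.sqrt (2 * m) * 4 ^ (2 * m / 3) *
      (2 * m) ^ (bertrandPrimes m).card) := by exact_mod_cast h1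
  have h3 := Real.log_le_log (by positivity) h2
  rw [Real.log_mul (by positivity) (by positivity), Real.log_mul (by positivity) (by positivity),
    Real.log_mul (by positivity) (by positivity), Real.log_pow, Real.log_pow, Real.log_pow,
    Real.log_pow] at h3
  have hl4 : 0 < Real.log 4 := Real.log_pos (by norm_num)
  have hm4 : (4 : ℝ) ≤ m := by exact_mod_cast hm
  have hl : 0 < Real.log (2 * m) := Real.log_pos (by linarith)
  have h4 : Real.log m ≤ Real.log (2 * m) := Real.log_le_log hm0 (by linarith)
  have h5 : ((Nat.sqrt (2 * m) : ℕ) : ℝ) ≤ √(2 * m) := by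
    have := @Real.nat_sqrt_le_real_sqrt (2 * m)
    simpa using this
  have h6 : ((2 * m / 3 : ℕ) : ℝ) ≤ 2 * m / 3 := by
    have := @Nat.cast_div_le ℝ _ _ _ (2 * m) 3
    simpa using this
  have h7 := mul_le_mul_of_nonneg_right h5 hl.le
  have h8 := mul_le_mul_of_nonneg_right h6 hl4.le
  linarith

theorem eventually_rpow_le_card_bertrandPrimes {δ : ℝ} (hδ : 0 < δ) (hδ' : δ ≤ 1 / 2) :
    ∀ᶠ m : ℕ in Filter.atTop, (2 * m : ℝ) ^ (1 - δ) ≤ (bertrandPrimes m).card := by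
  -- A third of `log 4 / 6`: the two subtracted terms and the target each take one share.
  have hlog := (isLittleO_log_rpow_atTop hδ).def (c := Real.log 4 / 18)
    (by have := Real.log_pos (by norm_num : (1 : ℝ) < 4); positivity)
  have htend : Filter.Tendsto (fun m : ℕ => (2 * m : ℝ)) Filter.atTop Filter.atTop :=
    (tendsto_natCast_atTop_atTop).const_mul_atTop two_pos
  filter_upwards [htend.eventually hlog, Filter.eventually_ge_atTop 4] with m h1 hm
  have key := log_le_card_bertrandPrimes_mul_log m hm
  have hm4 : (4 : ℝ) ≤ m := by exact_mod_cast hm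
  set x : ℝ := 2 * m with hx
  have hx1 : 1 < x := by linarith
  have hl : 0 < Real.log x := Real.log_pos hx1
  rw [Real.norm_of_nonneg hl.le, Real.norm_of_nonneg (by positivity)] at h1
  have h2 : x ^ (1 - δ) * x ^ δ = x := by
    rw [← Real.rpow_add (by linarith)]; simp
  have h3 : x ^ (1 - δ) * Real.log x ≤ Real.log 4 / 18 * x := by
    calc x ^ (1 - δ) * Real.log x ≤ x ^ (1 - δ) * (Real.log 4 / 18 * x ^ δ) := by gcongr
      _ = _ := by rw [mul_left_comm, h2]
  have h4 : √x ≤ x ^ (1 - δ) := by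
    rw [Real.sqrt_eq_rpow]
    exact Real.rpow_le_rpow_of_exponent_le hx1.le (by linarith)
  have h5 : 1 ≤ x ^ (1 - δ) := Real.one_le_rpow hx1.le (by linarith)
  have h6 := mul_le_mul_of_nonneg_right h4 hl.le
  have h7 := mul_le_mul_of_nonneg_right h5 hl.le
  refine le_of_mul_le_mul_right ?_ hl
  linarith

theorem bertrandPrimes_subset_primesUpTo {n : ℕ} (hn : 2 ≤ n) :
    bertrandPrimes ⌈(n : ℝ) / 2⌉₊ ⊆ primesUpTo n := by
  intro p hp
  simp only [bertrandPrimes, primesUpTo, Finset.mem_filter, Finset.mem_Ioc, Finset.mem_Icc] at hp ⊢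
  obtain ⟨⟨h1, h2⟩, hp⟩ := hp
  refine ⟨⟨h1, ?_⟩, hp⟩
  have h3 : (⌈(n : ℝ) / 2⌉₊ : ℝ) < n / 2 + 1 := Nat.ceil_lt_add_one (by positivity)
  have h4 : 2 * ⌈(n : ℝ) / 2⌉₊ < n + 2 := by
    have : (2 * ⌈(n : ℝ) / 2⌉₊ : ℝ) < n + 2 := by linarith
    exact_mod_cast this
  have h5 : (n : ℝ) / 2 ≤ (⌈(n : ℝ) / 2⌉₊ : ℝ) := Nat.le_ceil _
  -- For odd `n` the Bertrand interval reaches `n + 1`, which is even and exceeds `2`, hence is not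
  -- prime.
  by_contra hcon
  have h6 : p = 2 * ⌈(n : ℝ) / 2⌉₊ := by omega
  have : ⌈(n : ℝ) / 2⌉₊ = 1 := by
    have := (Nat.prime_mul_iff.1 (h6 ▸ hp))
    rcases this with h | h
    · exact h.2
    · omega
  omega

theorem le_two_mul_ceil_half (n : ℕ) : n ≤ 2 * ⌈(n : ℝ) / 2⌉₊ := by
  have h5 : (n : ℝ) / 2 ≤ (⌈(n : ℝ) / 2⌉₊ : ℝ) := Nat.le_ceil _
  have : (n : ℝ) ≤ 2 * ⌈(n : ℝ) / 2⌉₊ := by linarith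
  exact_mod_cast this

theorem primesUpTo_nonempty {n : ℕ} (hn : 2 ≤ n) : (primesUpTo n).Nonempty := by
  have h := le_two_mul_ceil_half n
  obtain ⟨p, hp, h1, h2⟩ := Nat.exists_prime_lt_and_le_two_mul ⌈(n : ℝ) / 2⌉₊ (by omega)
  refine ⟨p, bertrandPrimes_subset_primesUpTo hn ?_⟩
  simp [bertrandPrimes, hp, h1, h2]

theorem exists_mul_rpow_le_card_primesUpTo {δ : ℝ} (hδ : 0 < δ) (hδ' : δ ≤ 1 / 2) :
    ∃ c : ℝ, 0 < c ∧ ∀ n : ℕ, 2 ≤ n → c * (n : ℝ) ^ (1 - δ) ≤ (primesUpTo n).card := by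
  obtain ⟨N, hN⟩ := Filter.eventually_atTop.1 (eventually_rpow_le_card_bertrandPrimes hδ hδ')
  -- For small `n`, where `n ≤ 2N`, the single prime given by Bertrand's postulate suffices.
  refine ⟨1 / (2 * N + 1), by positivity, fun n hn => ?_⟩
  have h := le_two_mul_ceil_half n
  have hn1 : (1 : ℝ) ≤ n := by exact_mod_cast (by omega : 1 ≤ n)
  rw [one_div_mul_eq_div, div_le_iff₀ (by positivity)]
  have hc : (1 : ℝ) ≤ (primesUpTo n).card := by
    exact_mod_cast Finset.card_pos.2 (primesUpTo_nonempty hn)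
  by_cases hcase : N ≤ ⌈(n : ℝ) / 2⌉₊
  · have h1 : (n : ℝ) ^ (1 - δ) ≤ (2 * (⌈(n : ℝ) / 2⌉₊ : ℝ)) ^ (1 - δ) := by
      refine Real.rpow_le_rpow (by positivity) (by exact_mod_cast h) (by linarith)
    have h2 := hN _ hcase
    have h3 : ((bertrandPrimes ⌈(n : ℝ) / 2⌉₊).card : ℝ) ≤ (primesUpTo n).card := by
      exact_mod_cast Finset.card_le_card (bertrandPrimes_subset_primesUpTo hn)
    nlinarith [h1, h2, h3, (Nat.cast_nonneg N : (0 : ℝ) ≤ N)]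
  · have h1 : (n : ℝ) ^ (1 - δ) ≤ n := by
      simpa using Real.rpow_le_rpow_of_exponent_le hn1 (by linarith : 1 - δ ≤ 1)
    have h2 : (n : ℝ) ≤ 2 * N := by exact_mod_cast (by omega : n ≤ 2 * N)
    nlinarith [(Nat.cast_nonneg N : (0 : ℝ) ≤ N)]

/-! ### Medians -/

theorem le_realMedian_of_card {m : ℕ} (x : Fin (2 * m + 1) → ℝ) (a : ℝ)
    (hx : (Finset.univ.filter fun i => x i < a).card ≤ m) : a ≤ realMedian x := by
  by_contra hlt
  push Not at hlt
  have hsub : (Finset.Iic (⟨m, by omega⟩ : Fin (2 * m + 1))).map (Tuple.sort x).toEmbedding ⊆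
      Finset.univ.filter fun i => x i < a := by
    intro i hi
    obtain ⟨j, hj, rfl⟩ := Finset.mem_map.1 hi
    simp only [Finset.mem_filter, Finset.mem_univ, true_and]
    exact (Tuple.monotone_sort x (Finset.mem_Iic.1 hj)).trans_lt hlt
  have := Finset.card_le_card hsub
  simp at this
  omega

theorem realMedian_le_of_card {m : ℕ} (x : Fin (2 * m + 1) → ℝ) (a : ℝ)
    (hx : (Finset.univ.filter fun i => a < x i).card ≤ m) : realMedian x ≤ a := by
  by_contra hlt
  push Not at hlt
  have hsub : (Finset.Ici (⟨m, by omega⟩ : Fin (2 * m + 1))).map (Tuple.sort x).toEmbedding ⊆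
      Finset.univ.filter fun i => a < x i := by
    intro i hi
    obtain ⟨j, hj, rfl⟩ := Finset.mem_map.1 hi
    simp only [Finset.mem_filter, Finset.mem_univ, true_and]
    exact hlt.trans_le (Tuple.monotone_sort x (Finset.mem_Ici.1 hj))
  have := Finset.card_le_card hsub
  simp at this
  omega

theorem abs_sub_realMedian_le {m : ℕ} (x : Fin (2 * m + 1) → ℝ) (c t : ℝ)
    (hx : (Finset.univ.filter fun i => t < |c - x i|).card ≤ m) : |c - realMedian x| ≤ t := by
  have h1 : c - t ≤ realMedian x := by
    refine le_realMedian_of_card x _ ((Finset.card_le_card fun i hi => ?_).trans hx)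
    simp only [Finset.mem_filter, Finset.mem_univ, true_and] at hi ⊢
    exact lt_of_lt_of_le (by linarith) (le_abs_self _)
  have h2 : realMedian x ≤ c + t := by
    refine realMedian_le_of_card x _ ((Finset.card_le_card fun i hi => ?_).trans hx)
    simp only [Finset.mem_filter, Finset.mem_univ, true_and] at hi ⊢
    exact lt_of_lt_of_le (by linarith) (neg_le_abs _)
  rw [abs_le]
  constructor <;> linarith

/-- A large deviation of either part forces a large complex one, so both real medians are within
`t`; adding the two parts costs the factor `2`. -/
theorem norm_sub_complexMedian_le {m : ℕ} (x : Fin (2 * m + 1) → ℂ) (c : ℂ) (t : ℝ)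
    (hx : (Finset.univ.filter fun i => t < ‖c - x i‖).card ≤ m) :
    ‖c - complexMedian x‖ ≤ 2 * t := by
  have hre : |c.re - realMedian fun i => (x i).re| ≤ t := by
    refine abs_sub_realMedian_le _ _ _ ((Finset.card_le_card fun i hi => ?_).trans hx)
    simp only [Finset.mem_filter, Finset.mem_univ, true_and] at hi ⊢
    exact hi.trans_le (by simpa using Complex.abs_re_le_norm (c - x i))
  have him : |c.im - realMedian fun i => (x i).im| ≤ t := by
    refine abs_sub_realMedian_le _ _ _ ((Finset.card_le_card fun i hi => ?_).trans hx)
    simp only [Finset.mem_filter, Finset.mem_univ, true_and] at hi ⊢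
    exact hi.trans_le (by simpa using Complex.abs_im_le_norm (c - x i))
  have := Complex.norm_le_abs_re_add_abs_im (c - complexMedian x)
  refine this.trans ?_
  change |c.re - realMedian fun i => (x i).re| + |c.im - realMedian fun i => (x i).im| ≤ 2 * t
  linarith

theorem enorm_sub_complexMedian_le {m : ℕ} (x : Fin (2 * m + 1) → ℂ) (c : ℂ) (t : ℝ≥0∞)
    (hx : (Finset.univ.filter fun i => t < ‖c - x i‖ₑ).card ≤ m) :
    ‖c - complexMedian x‖ₑ ≤ 2 * t := by
  by_cases ht : t = ⊤
  · simp [ht]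
  lift t to NNReal using ht
  have h := norm_sub_complexMedian_le x c t (by
    refine le_trans (le_of_eq ?_) hx
    congr 1
    ext i
    simp only [Finset.mem_filter, Finset.mem_univ, true_and, enorm_eq_nnnorm]
    rw [ENNReal.coe_lt_coe, ← NNReal.coe_lt_coe, coe_nnnorm])
  rw [enorm_eq_nnnorm]
  have h' : ‖c - complexMedian x‖₊ ≤ 2 * t := by
    rw [← NNReal.coe_le_coe]; simpa using h
  exact_mod_cast h'

/-! ### Independent repetitions -/

/-- Union bound over the `(2m+1 choose m+1) ≤ 4^m` sets of `m + 1` failing repetitions. -/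
theorem pi_card_le {X : Type*} [MeasurableSpace X] (P : Measure X) [IsProbabilityMeasure P]
    (m : ℕ) (B : Set X) :
    (Measure.pi fun _ : Fin (2 * m + 1) => P)
        {ω | ∃ A : Finset (Fin (2 * m + 1)), A.card = m + 1 ∧ ∀ i ∈ A, ω i ∈ B} ≤
      4 ^ m * P B ^ (m + 1) := by
  classical
  have hset : {ω : Fin (2 * m + 1) → X |
      ∃ A : Finset (Fin (2 * m + 1)), A.card = m + 1 ∧ ∀ i ∈ A, ω i ∈ B} =
      ⋃ A ∈ Finset.univ.powersetCard (m + 1),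
        Set.univ.pi fun i : Fin (2 * m + 1) => if i ∈ A then B else Set.univ := by
    ext ω
    simp only [Set.mem_ofPred_eq, Set.mem_iUnion, Finset.mem_powersetCard, Finset.subset_univ,
      true_and, exists_prop, Set.mem_pi, Set.mem_univ, true_implies]
    refine exists_congr fun A => and_congr_right fun _ => forall_congr' fun i => ?_
    split_ifs with hi <;> simp [hi]
  rw [hset]
  refine (measure_biUnion_finset_le _ _).trans ?_
  have hterm : ∀ A ∈ (Finset.univ : Finset (Fin (2 * m + 1))).powersetCard (m + 1),
      (Measure.pi fun _ : Fin (2 * m + 1) => P)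
        (Set.univ.pi fun i : Fin (2 * m + 1) => if i ∈ A then B else Set.univ) =
        P B ^ (m + 1) := by
    intro A hA
    rw [Measure.pi_pi]
    simp only [apply_ite P, measure_univ]
    rw [Finset.prod_ite, Finset.prod_const_one, mul_one, Finset.prod_const]
    congr 1
    simpa using (Finset.mem_powersetCard.1 hA).2
  rw [Finset.sum_congr rfl hterm, Finset.sum_const, Finset.card_powersetCard, nsmul_eq_mul,
    Finset.card_fin, Nat.choose_symm_half]
  gcongr
  exact_mod_cast Nat.choose_middle_le_pow m

theorem pi_card_gt_le {X : Type*} [MeasurableSpace X] (P : Measure X) [IsProbabilityMeasure P]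
    (m : ℕ) (B : Set X) (hB : P B ≤ 1 / 8) (b : X → Prop) [DecidablePred b]
    (hb : ∀ x, b x → x ∈ B) :
    (Measure.pi fun _ : Fin (2 * m + 1) => P)
        {ω | m < (Finset.univ.filter fun i => b (ω i)).card} ≤ (1 / 2) ^ m := by
  calc _ ≤ _ := measure_mono fun ω hω => ?_
    _ ≤ _ := pi_card_le P m B
    _ ≤ 4 ^ m * (1 / 8) ^ m := by
      rw [pow_succ]
      refine mul_le_mul_right ?_ _
      exact (mul_le_mul' (pow_le_pow_left' hB m) prob_le_one).trans_eq (mul_one _)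
    _ = (1 / 2) ^ m := by
      rw [← mul_pow]
      congr 1
      rw [← ENNReal.toReal_eq_toReal_iff' (by finiteness) (by finiteness)]
      norm_num
  obtain ⟨A, hA, hcard⟩ := Finset.exists_subset_card_eq (Nat.succ_le_of_lt hω)
  exact ⟨A, hcard, fun i hi => hb _ (Finset.mem_filter.1 (hA hi)).2⟩

/-- This is what fixes the number of repetitions: `2^(-h(n) log₂ n) = n^(-h(n))`. -/
theorem half_pow_halfReps_le (h : ℕ → ℝ) {n : ℕ} (hn : 2 ≤ n) :
    (1 / 2 : ℝ≥0∞) ^ halfReps h n ≤ ENNReal.ofReal ((n : ℝ) ^ (-h n)) := by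
  have hn0 : (0 : ℝ) < n := by positivity
  have h1 : (1 / 2 : ℝ≥0∞) ^ halfReps h n = ENNReal.ofReal ((1 / 2 : ℝ) ^ halfReps h n) := by
    rw [ENNReal.ofReal_pow (by norm_num), ENNReal.ofReal_div_of_pos (by norm_num)]
    simp
  rw [h1]
  refine ENNReal.ofReal_le_ofReal ?_
  have h2 : (n : ℝ) ^ (-h n) = (2 : ℝ) ^ (-(h n * Real.logb 2 n)) := by
    nth_rw 1 [← Real.rpow_logb (b := 2) two_pos (by norm_num) hn0]
    rw [← Real.rpow_mul (by norm_num)]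
    congr 1
    ring
  rw [h2, one_div, inv_pow, ← Real.rpow_natCast, ← Real.rpow_neg (by norm_num)]
  refine Real.rpow_le_rpow_of_exponent_le (by norm_num) (neg_le_neg ?_)
  exact Nat.le_ceil _

/-! ### The weights -/

/-- The factor of `rWeight` that belongs to one coordinate. -/
def coordWeight (α g : ℝ) (m : ℤ) : ℝ :=
  if m = 0 then 1 else g⁻¹ * |(m : ℝ)| ^ α

theorem rWeight_eq_prod {d : ℕ} (α : ℝ) (γ : ℕ → ℝ) (k : Fin d → ℤ) :
    rWeight α γ k = ∏ j : Fin d, coordWeight α (γ j) (k j) := by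
  rw [rWeight, supp, ← Finset.prod_inv_distrib, ← Finset.prod_mul_distrib, Finset.prod_filter]
  refine Finset.prod_congr rfl fun j _ => ?_
  by_cases h : k j = 0 <;> simp [coordWeight, h]

theorem one_le_abs_rpow {α : ℝ} (hα : 0 < α) {m : ℤ} (hm : m ≠ 0) : 1 ≤ |(m : ℝ)| ^ α := by
  refine Real.one_le_rpow ?_ hα.le
  exact_mod_cast Int.one_le_abs hm

theorem abs_rpow_le_coordWeight {α g : ℝ} (hg : 0 < g ∧ g ≤ 1) {m : ℤ} (hm : m ≠ 0) :
    |(m : ℝ)| ^ α ≤ coordWeight α g m := by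
  rw [coordWeight, if_neg hm]
  exact le_mul_of_one_le_left (by positivity) ((one_le_inv₀ hg.1).2 hg.2)

theorem one_le_coordWeight {α g : ℝ} (hα : 0 < α) (hg : 0 < g ∧ g ≤ 1) (m : ℤ) :
    1 ≤ coordWeight α g m := by
  by_cases hm : m = 0
  · simp [coordWeight, hm]
  · exact (one_le_abs_rpow hα hm).trans (abs_rpow_le_coordWeight hg hm)

theorem one_le_rWeight {d : ℕ} {α : ℝ} {γ : ℕ → ℝ} (hα : 0 < α) (hγ : ∀ j, 0 < γ j ∧ γ j ≤ 1)
    (k : Fin d → ℤ) : 1 ≤ rWeight α γ k := by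
  rw [rWeight_eq_prod]
  exact Finset.prod_induction _ (fun x => 1 ≤ x) (fun _ _ => one_le_mul_of_one_le_of_one_le) le_rfl
    fun j _ => one_le_coordWeight hα (hγ j) (k j)

theorem abs_rpow_le_rWeight {d : ℕ} {α : ℝ} {γ : ℕ → ℝ} (hα : 0 < α)
    (hγ : ∀ j, 0 < γ j ∧ γ j ≤ 1) (k : Fin d → ℤ) {j : Fin d} (hj : k j ≠ 0) :
    |(k j : ℝ)| ^ α ≤ rWeight α γ k := by
  rw [rWeight_eq_prod, ← Finset.mul_prod_erase _ _ (Finset.mem_univ j)]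
  have h1 := abs_rpow_le_coordWeight (α := α) (hγ j) hj
  have h2 : 1 ≤ ∏ i ∈ (Finset.univ : Finset (Fin d)).erase j, coordWeight α (γ i) (k i) :=
    Finset.prod_induction _ (fun x => 1 ≤ x) (fun _ _ => one_le_mul_of_one_le_of_one_le) le_rfl
      fun i _ => one_le_coordWeight hα (hγ i) (k i)
  exact h1.trans (le_mul_of_one_le_right ((by positivity : (0 : ℝ) ≤ _).trans h1) h2)

/-- The weight `rWeight` as an extended nonnegative real. -/
def eWeight {d : ℕ} (α : ℝ) (γ : ℕ → ℝ) (k : Fin d → ℤ) : ℝ≥0∞ :=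
  ENNReal.ofReal (rWeight α γ k)

theorem eWeight_ne_top {d : ℕ} (α : ℝ) (γ : ℕ → ℝ) (k : Fin d → ℤ) : eWeight α γ k ≠ ⊤ :=
  ENNReal.ofReal_ne_top

theorem one_le_eWeight {d : ℕ} {α : ℝ} {γ : ℕ → ℝ} (hα : 0 < α) (hγ : ∀ j, 0 < γ j ∧ γ j ≤ 1)
    (k : Fin d → ℤ) : 1 ≤ eWeight α γ k := by
  simpa [eWeight] using one_le_rWeight hα hγ k

theorem tsum_prod_eq_prod_tsum {d : ℕ} (g : Fin d → ℤ → ℝ≥0∞) :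
    ∑' k : Fin d → ℤ, ∏ j, g j (k j) = ∏ j, ∑' m, g j m := by
  induction d with
  | zero => simp
  | succ d ih =>
    rw [← (Fin.consEquiv fun _ => ℤ).tsum_eq, ENNReal.tsum_prod', Fin.prod_univ_succ, ← ih,
      ← ENNReal.tsum_mul_right]
    refine tsum_congr fun m => ?_
    rw [← ENNReal.tsum_mul_left]
    refine tsum_congr fun k => ?_
    simp [Fin.prod_univ_succ, Fin.consEquiv]

theorem exists_tsum_eWeight_rpow_le {α a : ℝ} (ha : 1 < α * a) :
    ∃ z : ℝ, 0 ≤ z ∧ ∀ (γ : ℕ → ℝ), (∀ j, 0 < γ j ∧ γ j ≤ 1) → ∀ d : ℕ,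
      ∑' k : Fin d → ℤ, eWeight α γ k ^ (-a) ≤
        ENNReal.ofReal (∏ j : Fin d, (1 + z * γ j ^ a)) := by
  have hsum : Summable fun m : ℤ => |(m : ℝ)| ^ (-(α * a)) := Real.summable_abs_int_rpow ha
  -- The term `m = 0` is `0`, being a nonzero power of `0`; the zero entry of `k` supplies the
  -- separate summand `1` in each factor.
  refine ⟨∑' m : ℤ, |(m : ℝ)| ^ (-(α * a)), tsum_nonneg fun m => by positivity, ?_⟩
  set z := ∑' m : ℤ, |(m : ℝ)| ^ (-(α * a)) with hz
  have hz0 : 0 ≤ z := tsum_nonneg fun m => by positivity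
  intro γ hγ d
  have hcw : ∀ (j : Fin d) (m : ℤ), 0 < coordWeight α (γ j) m := by
    intro j m
    rw [coordWeight]
    split_ifs with h
    · exact one_pos
    · have : (0 : ℝ) < |(m : ℝ)| := abs_pos.2 (by exact_mod_cast h)
      have := (hγ j).1
      positivity
  have hterm : ∀ k : Fin d → ℤ, eWeight α γ k ^ (-a) =
      ∏ j : Fin d, ENNReal.ofReal (coordWeight α (γ j) (k j) ^ (-a)) := by
    intro k
    rw [eWeight, rWeight_eq_prod, ENNReal.ofReal_rpow_of_pos (Finset.prod_pos fun j _ => hcw j _),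
      ← ENNReal.ofReal_prod_of_nonneg fun j _ => Real.rpow_nonneg (hcw j _).le _,
      Real.finsetProd_rpow _ _ fun j _ => (hcw j _).le]
  simp_rw [hterm]
  rw [tsum_prod_eq_prod_tsum fun (j : Fin d) m => ENNReal.ofReal (coordWeight α (γ j) m ^ (-a)),
    ENNReal.ofReal_prod_of_nonneg fun j _ => by
      have := (hγ j).1
      positivity]
  refine Finset.prod_le_prod' fun j _ => ?_
  have hg := (hγ j).1
  calc ∑' m : ℤ, ENNReal.ofReal (coordWeight α (γ j) m ^ (-a))
      ≤ ∑' m : ℤ, ((if m = 0 then 1 else 0) +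
          ENNReal.ofReal (γ j ^ a) * ENNReal.ofReal (|(m : ℝ)| ^ (-(α * a)))) := by
        refine ENNReal.tsum_le_tsum fun m => ?_
        by_cases hm : m = 0
        · simp [hm, coordWeight]
        · rw [if_neg hm, zero_add, ← ENNReal.ofReal_mul (by positivity), coordWeight, if_neg hm]
          refine ENNReal.ofReal_le_ofReal (le_of_eq ?_)
          rw [Real.mul_rpow (by positivity) (by positivity), ← Real.rpow_mul (by positivity),
            Real.inv_rpow hg.le, Real.rpow_neg hg.le, inv_inv]
          congr 2
          ring
    _ = 1 + ENNReal.ofReal (γ j ^ a) * ENNReal.ofReal z := by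
        rw [ENNReal.tsum_add, tsum_ite_eq, ENNReal.tsum_mul_left, hz,
          ENNReal.ofReal_tsum_of_nonneg (fun m => by positivity) hsum]
    _ = ENNReal.ofReal (1 + z * γ j ^ a) := by
        rw [ENNReal.ofReal_add zero_le_one (by positivity), ENNReal.ofReal_mul hz0,
          ENNReal.ofReal_one, mul_comm]

/-- `1 + x ≤ exp x` turns the product into the exponential of a sum, and `γ_j^a ≤ γ_j^(1/α)` because
`γ_j ≤ 1`. The resulting `S` is free of `d`. -/
theorem exists_tsum_eWeight_rpow_le_of_summable {α a : ℝ} (hα : 0 < α) (ha : 1 < α * a)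
    {γ : ℕ → ℝ} (hγ : ∀ j, 0 < γ j ∧ γ j ≤ 1) (hsum : Summable fun j => γ j ^ (1 / α)) :
    ∃ S : ℝ, 0 < S ∧ ∀ d : ℕ,
      ∑' k : Fin d → ℤ, eWeight α γ k ^ (-a) ≤ ENNReal.ofReal S := by
  obtain ⟨z, hz, h⟩ := exists_tsum_eWeight_rpow_le ha
  refine ⟨Real.exp (z * ∑' j, γ j ^ (1 / α)), Real.exp_pos _, fun d => (h γ hγ d).trans ?_⟩
  refine ENNReal.ofReal_le_ofReal ?_
  calc ∏ j : Fin d, (1 + z * γ j ^ a) ≤ ∏ j : Fin d, Real.exp (z * γ j ^ (1 / α)) := by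
        refine Finset.prod_le_prod (fun j _ => ?_) fun j _ => ?_
        · have := (hγ j).1
          positivity
        · have h1 : γ j ^ a ≤ γ j ^ (1 / α) := by
            refine Real.rpow_le_rpow_of_exponent_ge (hγ j).1 (hγ j).2 ?_
            rw [div_le_iff₀ hα]
            linarith
          have h2 := Real.add_one_le_exp (z * γ j ^ (1 / α))
          have h3 := mul_le_mul_of_nonneg_left h1 hz
          linarith
    _ = Real.exp (z * ∑ j : Fin d, γ j ^ (1 / α)) := by
        rw [Finset.mul_sum, Real.exp_sum]
    _ ≤ _ := by
        gcongr
        rw [Fin.sum_univ_eq_sum_range fun j => γ j ^ (1 / α)]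
        exact hsum.sum_le_tsum _ fun j _ => Real.rpow_nonneg (hγ j).1.le _

/-! ### The error of a lattice rule -/

/-- The frequencies that contribute to the error of the lattice rule with parameter `(p, z)`:
the nonzero elements of the dual lattice. (With `p = 0`, where the rule is identically `0`, also
the frequency `0` contributes.) -/
def dualSet {d : ℕ} (x : ℕ × (Fin d → ℕ)) : Set (Fin d → ℤ) :=
  {k | (x.1 : ℤ) ∣ ∑ j, k j * (x.2 j : ℤ) ∧ (k ≠ 0 ∨ x.1 = 0)}

theorem expo_fract {d : ℕ} {p : ℕ} (z : Fin d → ℕ) (k : Fin d → ℤ) (l : ℕ) :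
    expo k (fun j => Int.fract ((l : ℝ) * (z j : ℝ) / (p : ℝ))) =
      (Complex.exp (2 * Real.pi * Complex.I / p) ^ (∑ j, k j * (z j : ℤ))) ^ l := by
  rw [expo, ← Complex.exp_int_mul, ← Complex.exp_nat_mul, Complex.exp_eq_exp_iff_exists_int]
  refine ⟨-∑ j, k j * ⌊(l : ℝ) * (z j : ℝ) / (p : ℝ)⌋, ?_⟩
  have : ∀ j, (k j : ℂ) * ((Int.fract ((l : ℝ) * (z j : ℝ) / (p : ℝ)) : ℝ) : ℂ) =
      (l : ℂ) / p * (k j * z j) - k j * (⌊(l : ℝ) * (z j : ℝ) / (p : ℝ)⌋ : ℂ) := by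
    intro j
    rw [← Int.self_sub_floor]
    push_cast
    ring
  simp_rw [this, Finset.sum_sub_distrib, ← Finset.mul_sum]
  push_cast
  ring

/-- Orthogonality of characters: a full geometric sum in a `p`-th root of unity. -/
theorem sum_expo_fract {d : ℕ} {p : ℕ} (hp : p ≠ 0) (z : Fin d → ℕ) (k : Fin d → ℤ) :
    (1 / (p : ℂ)) * ∑ l ∈ Finset.range p,
      expo k (fun j => Int.fract ((l : ℝ) * (z j : ℝ) / (p : ℝ))) =
      if (p : ℤ) ∣ ∑ j, k j * (z j : ℤ) then 1 else 0 := by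
  have hp' : (p : ℂ) ≠ 0 := by exact_mod_cast hp
  have hprim := Complex.isPrimitiveRoot_exp p hp
  simp_rw [expo_fract]
  set w := Complex.exp (2 * Real.pi * Complex.I / p) with hw
  split_ifs with h
  · rw [(hprim.zpow_eq_one_iff_dvd _).2 h]
    simp [hp']
  · have h1 : w ^ (∑ j, k j * (z j : ℤ)) ≠ 1 := fun h' => h ((hprim.zpow_eq_one_iff_dvd _).1 h')
    rw [geom_sum_eq h1, ← zpow_natCast, ← zpow_mul, mul_comm _ (p : ℤ), zpow_mul, zpow_natCast,
      hprim.pow_eq_one]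
    simp

theorem fourierCoef_zero {d : ℕ} (f : (Fin d → ℝ) → ℂ) : fourierCoef f 0 = cubeIntegral f := by
  simp [fourierCoef, expo]

theorem hasSum_latticeRule {d : ℕ} {α : ℝ} {γ : ℕ → ℝ} {f : (Fin d → ℝ) → ℂ}
    (hf : MemKorobov α γ f) {p : ℕ} (hp : p ≠ 0) (z : Fin d → ℕ) :
    HasSum (fun k : Fin d → ℤ =>
      fourierCoef f k * if (p : ℤ) ∣ ∑ j, k j * (z j : ℤ) then 1 else 0) (latticeRule p z f) := by
  have h : ∀ l ∈ Finset.range p, HasSum (fun k : Fin d → ℤ => fourierCoef f k *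
      expo k (fun j => Int.fract ((l : ℝ) * (z j : ℝ) / (p : ℝ))))
      (f fun j => Int.fract ((l : ℝ) * (z j : ℝ) / (p : ℝ))) := fun l _ =>
    hf.2.1 _ ⟨fun j => Int.fract_nonneg _, fun j => (Int.fract_lt_one _).le⟩
  have h' := (hasSum_sum h).mul_left (1 / (p : ℂ))
  refine h'.congr_fun ?_
  intro k
  rw [← sum_expo_fract hp, ← Finset.mul_sum, mul_left_comm]

/-- The integral cancels the zero frequency. Admitting `p = 0` makes the bound hold for every
realization, so that no null set has to be removed later. -/
theorem enorm_sub_latticeRule_le {d : ℕ} {α : ℝ} {γ : ℕ → ℝ} {f : (Fin d → ℝ) → ℂ}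
    (hf : MemKorobov α γ f) (x : ℕ × (Fin d → ℕ)) :
    ‖cubeIntegral f - latticeRule x.1 x.2 f‖ₑ ≤
      ∑' k, (dualSet x).indicator (fun k => ‖fourierCoef f k‖ₑ) k := by
  obtain ⟨p, z⟩ := x
  by_cases hp : p = 0
  · subst hp
    have hmem : (0 : Fin d → ℤ) ∈ dualSet ((0 : ℕ), z) := by simp [dualSet]
    refine le_trans (le_of_eq ?_) (ENNReal.le_tsum 0)
    rw [Set.indicator_of_mem hmem, fourierCoef_zero]
    simp [latticeRule]
  · have h1 := (hasSum_ite_eq (0 : Fin d → ℤ) (fourierCoef f 0)).sub (hasSum_latticeRule hf hp z)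
    rw [← fourierCoef_zero, ← h1.tsum_eq]
    refine enorm_tsum_le_tsum_enorm.trans (ENNReal.tsum_le_tsum fun k => ?_)
    by_cases hk : k = 0
    · subst hk; simp
    · by_cases hdvd : (p : ℤ) ∣ ∑ j, k j * (z j : ℤ)
      · have hmem : k ∈ dualSet (p, z) := ⟨hdvd, Or.inl hk⟩
        rw [Set.indicator_of_mem hmem]
        simp [hk, hdvd]
      · simp [hk, hdvd]

/-! ### Functions in the unit ball -/

theorem tsum_eWeight_sq_le {d : ℕ} {α : ℝ} {γ : ℕ → ℝ} {f : (Fin d → ℝ) → ℂ}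
    (hf : f ∈ korobovBall d α γ) (hα : 0 < α) (hγ : ∀ j, 0 < γ j ∧ γ j ≤ 1) :
    ∑' k, (eWeight α γ k * ‖fourierCoef f k‖ₑ) ^ (2 : ℝ) ≤ 1 := by
  obtain ⟨⟨-, -, hsum⟩, hnorm⟩ := hf
  replace hnorm := (Real.sqrt_le_iff.1 hnorm).2
  have h1 : ∀ k, (eWeight α γ k * ‖fourierCoef f k‖ₑ) ^ (2 : ℝ) =
      ENNReal.ofReal (rWeight α γ k ^ 2 * ‖fourierCoef f k‖ ^ 2) := by
    intro k
    have : 0 ≤ rWeight α γ k := zero_le_one.trans (one_le_rWeight hα hγ k)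
    rw [eWeight, ← ofReal_norm, ← ENNReal.ofReal_mul this,
      ENNReal.ofReal_rpow_of_nonneg (by positivity) (by norm_num), Real.rpow_two, mul_pow]
  simp_rw [h1]
  rw [← ENNReal.ofReal_tsum_of_nonneg (fun k => by positivity) hsum]
  simpa using hnorm

/-- Cauchy–Schwarz against the Korobov norm. It is used with `g` the indicator of a dual lattice,
`r^δ` on a set of frequencies, and `1`. -/
theorem tsum_mul_enorm_fourierCoef_le {d : ℕ} {α : ℝ} {γ : ℕ → ℝ} {f : (Fin d → ℝ) → ℂ}
    (hf : f ∈ korobovBall d α γ) (hα : 0 < α) (hγ : ∀ j, 0 < γ j ∧ γ j ≤ 1)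
    (g : (Fin d → ℤ) → ℝ≥0∞) :
    ∑' k, g k * ‖fourierCoef f k‖ₑ ≤
      (∑' k, (g k * (eWeight α γ k)⁻¹) ^ (2 : ℝ)) ^ (1 / 2 : ℝ) := by
  let _ : MeasurableSpace (Fin d → ℤ) := ⊤
  have h := ENNReal.lintegral_mul_le_Lp_mul_Lq (μ := Measure.count)
    Real.HolderConjugate.two_two (f := fun k => g k * (eWeight α γ k)⁻¹)
    (g := fun k => eWeight α γ k * ‖fourierCoef f k‖ₑ)
    (measurable_from_top).aemeasurable (measurable_from_top).aemeasurable
  simp only [lintegral_count, Pi.mul_apply] at h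
  calc ∑' k, g k * ‖fourierCoef f k‖ₑ
      = ∑' k, g k * (eWeight α γ k)⁻¹ * (eWeight α γ k * ‖fourierCoef f k‖ₑ) := by
        refine tsum_congr fun k => ?_
        have h1 := one_le_eWeight hα hγ k
        rw [mul_assoc, ← mul_assoc _ (eWeight α γ k),
          ENNReal.inv_mul_cancel (one_pos.trans_le h1).ne' (eWeight_ne_top _ _ _), one_mul]
    _ ≤ _ := h
    _ ≤ (∑' k, (g k * (eWeight α γ k)⁻¹) ^ (2 : ℝ)) ^ (1 / 2 : ℝ) * 1 := by
        gcongr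
        exact ENNReal.rpow_le_one (tsum_eWeight_sq_le hf hα hγ) (by norm_num)
    _ = _ := mul_one _

/-! ### The law of a random lattice rule -/

theorem card_genVectors (d p : ℕ) : (genVectors d p).card = (p - 1) ^ d := by
  simp [genVectors, Fintype.card_piFinset]

theorem genVectors_nonempty (d : ℕ) {p : ℕ} (hp : 2 ≤ p) : (genVectors d p).Nonempty := by
  rw [← Finset.card_pos, card_genVectors]
  exact pow_pos (by omega) d

/-- As `k j` is invertible mod `p`, the other coordinates determine `z j`; overwriting `z j` by `1`
is therefore injective on the solutions. -/
theorem mul_card_filter_dvd_le {d p : ℕ} (hp : p.Prime) (k : Fin d → ℤ) {j : Fin d}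
    (hj : ¬ (p : ℤ) ∣ k j) :
    (p - 1) * ((genVectors d p).filter fun z => (p : ℤ) ∣ ∑ i, k i * (z i : ℤ)).card ≤
      (p - 1) ^ d := by
  classical
  set F := (genVectors d p).filter fun z => (p : ℤ) ∣ ∑ i, k i * (z i : ℤ) with hF
  have hcard : F.card ≤ (Fintype.piFinset fun i : Fin d =>
      if i = j then {1} else Finset.Icc 1 (p - 1)).card := by
    refine Finset.card_le_card_of_injOn (fun z => Function.update z j 1) ?_ ?_
    · intro z hz
      have hz := (Finset.mem_filter.1 hz).1
      simp only [genVectors, Fintype.mem_piFinset] at hz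
      simp only [Finset.mem_coe, Fintype.mem_piFinset]
      intro i
      by_cases hi : i = j
      · subst hi; simp
      · simpa [hi] using hz i
    · intro z hz z' hz' heq
      have hz := Finset.mem_filter.1 hz
      have hz' := Finset.mem_filter.1 hz'
      have hne : ∀ i, i ≠ j → z i = z' i := by
        intro i hi
        have := congrFun heq i
        simpa [hi] using this
      have hdiff : (p : ℤ) ∣ k j * ((z j : ℤ) - z' j) := by
        have := dvd_sub hz.2 hz'.2
        rw [← Finset.sum_sub_distrib, Finset.sum_eq_single j] at this
        · rwa [mul_sub]
        · intro i _ hi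
          rw [hne i hi, sub_self]
        · simp
      have hdvd := (Int.Prime.dvd_mul' hp hdiff).resolve_left hj
      have b1 := Finset.mem_Icc.1 ((Fintype.mem_piFinset.1 hz.1) j)
      have b2 := Finset.mem_Icc.1 ((Fintype.mem_piFinset.1 hz'.1) j)
      have hp1 := hp.one_lt
      have hzero : (z j : ℤ) - z' j = 0 := by
        refine Int.eq_zero_of_abs_lt_dvd hdvd ?_
        rw [abs_lt]
        constructor <;> omega
      funext i
      by_cases hi : i = j
      · subst hi; omega
      · exact hne i hi
  have hcard' : (Fintype.piFinset fun i : Fin d =>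
      if i = j then {1} else Finset.Icc 1 (p - 1)).card = (p - 1) ^ (d - 1) := by
    rw [Fintype.card_piFinset, ← Finset.mul_prod_erase _ _ (Finset.mem_univ j)]
    rw [Finset.prod_congr rfl (g := fun _ => p - 1)]
    · simp
    · intro i hi
      simp [Finset.ne_of_mem_erase hi]
  have hd : d ≠ 0 := by rintro rfl; exact j.elim0
  calc (p - 1) * F.card ≤ (p - 1) * (p - 1) ^ (d - 1) :=
        Nat.mul_le_mul_left _ (hcard.trans hcard'.le)
    _ = (p - 1) ^ d := by rw [← pow_succ', Nat.sub_add_cancel (Nat.pos_of_ne_zero hd)]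

theorem uniformOn_genVectors_dvd_le {d p : ℕ} (hp : p.Prime) (k : Fin d → ℤ) {j : Fin d}
    (hj : ¬ (p : ℤ) ∣ k j) :
    uniformOn (genVectors d p : Set (Fin d → ℕ)) {z | (p : ℤ) ∣ ∑ i, k i * (z i : ℤ)} ≤
      ((p - 1 : ℕ) : ℝ≥0∞)⁻¹ := by
  classical
  have hp1 := hp.two_le
  have hset : uniformOn (genVectors d p : Set (Fin d → ℕ)) {z | (p : ℤ) ∣ ∑ i, k i * (z i : ℤ)} =
      uniformOn (genVectors d p : Set (Fin d → ℕ))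
        ((genVectors d p).filter fun z => (p : ℤ) ∣ ∑ i, k i * (z i : ℤ) : Finset _) := by
    rw [← uniformOn_inter_self (genVectors d p).finite_toSet]
    congr 1
    ext z
    simp
  rw [hset, uniformOn_apply_finset, Finset.inter_eq_right.2 (Finset.filter_subset _ _),
    card_genVectors]
  refine ENNReal.div_le_of_le_mul ?_
  rw [mul_comm, ← div_eq_mul_inv, ENNReal.le_div_iff_mul_le
    (Or.inl (Nat.cast_ne_zero.2 (by omega))) (Or.inl (ENNReal.natCast_ne_top _)), mul_comm]
  exact_mod_cast mul_card_filter_dvd_le hp k hj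

theorem drawLaw_apply (d n : ℕ) (B : Set (ℕ × (Fin d → ℕ))) :
    drawLaw d n B = ∫⁻ p, uniformOn (genVectors d p : Set (Fin d → ℕ)) {z | (p, z) ∈ B}
      ∂uniformOn (primesUpTo n : Set ℕ) := by
  rw [drawLaw, Measure.bind_apply .of_discrete (measurable_of_countable _).aemeasurable]
  refine lintegral_congr fun p => ?_
  rw [Measure.map_apply (measurable_of_countable _) .of_discrete]
  rfl

theorem mem_primesUpTo {n p : ℕ} (hp : p ∈ primesUpTo n) :
    p.Prime ∧ (n : ℝ) / 2 ≤ (p - 1 : ℕ) := by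
  simp only [primesUpTo, Finset.mem_filter, Finset.mem_Icc] at hp
  refine ⟨hp.2, (Nat.le_ceil _).trans ?_⟩
  exact_mod_cast Nat.le_sub_one_of_lt hp.1.1

theorem ae_mem_primesUpTo (n : ℕ) :
    ∀ᵐ p ∂uniformOn (primesUpTo n : Set ℕ), p ∈ primesUpTo n :=
  ae_cond_mem .of_discrete

theorem isProbabilityMeasure_drawLaw (d : ℕ) {n : ℕ} (hn : 2 ≤ n) :
    IsProbabilityMeasure (drawLaw d n) := by
  have hP : IsProbabilityMeasure (uniformOn (primesUpTo n : Set ℕ)) :=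
    isProbabilityMeasure_uniformOn (primesUpTo n).finite_toSet (primesUpTo_nonempty hn)
  constructor
  rw [drawLaw_apply]
  have : ∀ᵐ p ∂uniformOn (primesUpTo n : Set ℕ),
      uniformOn (genVectors d p : Set (Fin d → ℕ)) {z | (p, z) ∈ Set.univ} = 1 := by
    filter_upwards [ae_mem_primesUpTo n] with p hp
    exact uniformOn_of_univ (genVectors d p).finite_toSet
      (genVectors_nonempty d (mem_primesUpTo hp).1.two_le)
  rw [lintegral_congr_ae this]
  simp

/-- The product of the distinct primes dividing `K` divides `K`, and each is at least `2`. -/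
theorem card_filter_dvd_mul_log_le (A : Finset ℕ) (hA : ∀ p ∈ A, p.Prime) {K : ℤ} (hK : K ≠ 0) :
    ((A.filter fun p : ℕ => (p : ℤ) ∣ K).card : ℝ) * Real.log 2 ≤ Real.log |(K : ℝ)| := by
  set F := A.filter fun p : ℕ => (p : ℤ) ∣ K with hF
  have hF' : ∀ p ∈ F, p.Prime ∧ p ∣ K.natAbs := fun p hp =>
    ⟨hA p (Finset.mem_filter.1 hp).1, Int.natCast_dvd.1 (Finset.mem_filter.1 hp).2⟩
  have h1 : ∏ p ∈ F, p ∣ K.natAbs :=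
    Finset.prod_primes_dvd _ (fun p hp => (hF' p hp).1.prime) fun p hp => (hF' p hp).2
  have h2 : 2 ^ F.card ≤ K.natAbs :=
    (Finset.pow_card_le_prod _ _ _ fun p hp => (hF' p hp).1.two_le).trans
      (Nat.le_of_dvd (Int.natAbs_pos.2 hK) h1)
  have h3 : (2 : ℝ) ^ F.card ≤ |(K : ℝ)| := by
    rw [← Int.cast_abs, Int.abs_eq_natAbs]
    exact_mod_cast h2
  rw [← Real.log_pow]
  exact Real.log_le_log (by positivity) h3

/-- If `p ∣ k j`, the conditional probability is bounded by `1`; otherwise by `1/(p-1) ≤ 2/n`. -/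
theorem drawLaw_mem_dualSet_le {d n : ℕ} (hn : 2 ≤ n) (k : Fin d → ℤ) (j : Fin d) :
    drawLaw d n {x | k ∈ dualSet x} ≤
      (((primesUpTo n).filter fun p : ℕ => (p : ℤ) ∣ k j).card : ℝ≥0∞) / (primesUpTo n).card +
        ENNReal.ofReal (2 / n) := by
  classical
  have hP : IsProbabilityMeasure (uniformOn (primesUpTo n : Set ℕ)) :=
    isProbabilityMeasure_uniformOn (primesUpTo n).finite_toSet (primesUpTo_nonempty hn)
  rw [drawLaw_apply]
  calc _ ≤ ∫⁻ p, ({p : ℕ | (p : ℤ) ∣ k j}.indicator 1 p + ENNReal.ofReal (2 / n))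
        ∂uniformOn (primesUpTo n : Set ℕ) := by
        refine lintegral_mono_ae ?_
        filter_upwards [ae_mem_primesUpTo n] with p hp
        obtain ⟨hp, hpn⟩ := mem_primesUpTo hp
        by_cases hdvd : (p : ℤ) ∣ k j
        · rw [Set.indicator_of_mem (by exact hdvd)]
          have : IsProbabilityMeasure (uniformOn (genVectors d p : Set (Fin d → ℕ))) :=
            isProbabilityMeasure_uniformOn (genVectors d p).finite_toSet
              (genVectors_nonempty d hp.two_le)
          exact prob_le_one.trans le_self_add
        · refine le_trans ?_ le_add_self
          refine (measure_mono fun z hz => hz.1).trans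
            ((uniformOn_genVectors_dvd_le hp k hdvd).trans ?_)
          have hn0 : (0 : ℝ) < n / 2 := by positivity
          rw [← ENNReal.ofReal_natCast, ← ENNReal.ofReal_inv_of_pos (hn0.trans_le hpn)]
          refine ENNReal.ofReal_le_ofReal ?_
          rw [← inv_div]
          exact inv_anti₀ hn0 hpn
    _ = uniformOn (primesUpTo n : Set ℕ) {p : ℕ | (p : ℤ) ∣ k j} + ENNReal.ofReal (2 / n) := by
        rw [lintegral_add_right _ measurable_const, lintegral_indicator_one .of_discrete]
        simp
    _ = _ := by
        congr 1
        rw [← uniformOn_inter_self (primesUpTo n).finite_toSet]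
        have : (primesUpTo n : Set ℕ) ∩ {p : ℕ | (p : ℤ) ∣ k j} =
            ((primesUpTo n).filter fun p : ℕ => (p : ℤ) ∣ k j : Finset ℕ) := by
          ext p; simp
        rw [this, uniformOn_apply_finset, Finset.inter_eq_right.2 (Finset.filter_subset _ _)]

theorem drawLaw_zero_mem_dualSet (d n : ℕ) :
    drawLaw d n {x | (0 : Fin d → ℤ) ∈ dualSet x} = 0 := by
  rw [drawLaw_apply, lintegral_eq_zero_iff (measurable_of_countable _)]
  filter_upwards [ae_mem_primesUpTo n] with p hp
  simp [dualSet, (mem_primesUpTo hp).1.ne_zero]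

theorem exists_drawLaw_mem_dualSet_le {α δ : ℝ} (hα : 0 < α) (hδ : 0 < δ) (hδ' : δ ≤ 1 / 2) :
    ∃ K : ℝ, 0 < K ∧ ∀ γ : ℕ → ℝ, (∀ j, 0 < γ j ∧ γ j ≤ 1) → ∀ d n : ℕ, 2 ≤ n →
      ∀ k : Fin d → ℤ, drawLaw d n {x | k ∈ dualSet x} ≤
        ENNReal.ofReal (K * (n : ℝ) ^ (-(1 - δ))) * eWeight α γ k ^ δ := by
  obtain ⟨c, hc, hcard⟩ := exists_mul_rpow_le_card_primesUpTo hδ hδ'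
  have hl2 : 0 < Real.log 2 := Real.log_pos (by norm_num)
  refine ⟨1 / (Real.log 2 * (α * δ) * c) + 2, by positivity, fun γ hγ d n hn k => ?_⟩
  by_cases hk : k = 0
  · subst hk
    rw [drawLaw_zero_mem_dualSet]
    exact zero_le
  obtain ⟨j, hj⟩ : ∃ j, k j ≠ 0 := by
    by_contra! h
    exact hk (funext h)
  refine (drawLaw_mem_dualSet_le hn k j).trans ?_
  have hr1 := one_le_rWeight hα hγ k
  have hr0 : 0 < rWeight α γ k := one_pos.trans_le hr1
  have hn1 : (1 : ℝ) ≤ n := by exact_mod_cast (by omega : 1 ≤ n)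
  have hn0 : (0 : ℝ) < n := by linarith
  have hP : (0 : ℝ) < (primesUpTo n).card := by
    exact_mod_cast Finset.card_pos.2 (primesUpTo_nonempty hn)
  rw [eWeight, ENNReal.ofReal_rpow_of_pos hr0, ← ENNReal.ofReal_mul (by positivity),
    ← ENNReal.ofReal_natCast, ← ENNReal.ofReal_natCast, ← ENNReal.ofReal_div_of_pos hP,
    ← ENNReal.ofReal_add (by positivity) (by positivity)]
  refine ENNReal.ofReal_le_ofReal ?_
  set N : ℝ := (((primesUpTo n).filter fun p : ℕ => (p : ℤ) ∣ k j).card : ℝ) with hN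
  have hkj : 0 < |(k j : ℝ)| := abs_pos.2 (by exact_mod_cast hj)
  have h1 : N * Real.log 2 ≤ rWeight α γ k ^ δ / (α * δ) := by
    refine (card_filter_dvd_mul_log_le _ (fun p hp => (mem_primesUpTo hp).1) hj).trans ?_
    -- The logarithm is traded for the power `αδ`, which `|k j|^α ≤ r(k)` turns into `r(k)^δ`.
    refine (Real.log_le_rpow_div hkj.le (by positivity : 0 < α * δ)).trans ?_
    rw [Real.rpow_mul hkj.le]
    gcongr
    exact abs_rpow_le_rWeight hα hγ k hj
  have h2 := hcard n hn
  have hrd : 1 ≤ rWeight α γ k ^ δ := Real.one_le_rpow hr1 hδ.le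
  have hnp : (n : ℝ) ^ (-(1 - δ)) = ((n : ℝ) ^ (1 - δ))⁻¹ := Real.rpow_neg hn0.le _
  have h3 : N / (primesUpTo n).card ≤
      1 / (Real.log 2 * (α * δ) * c) * (n : ℝ) ^ (-(1 - δ)) * rWeight α γ k ^ δ := by
    have hN' : N ≤ rWeight α γ k ^ δ / (α * δ) / Real.log 2 := by rwa [le_div_iff₀ hl2]
    calc N / (primesUpTo n).card
        ≤ (rWeight α γ k ^ δ / (α * δ) / Real.log 2) / (c * (n : ℝ) ^ (1 - δ)) := by gcongr
      _ = _ := by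
        rw [hnp]
        field_simp
  have h4 : 2 / (n : ℝ) ≤ 2 * (n : ℝ) ^ (-(1 - δ)) * rWeight α γ k ^ δ := by
    have h5 : (n : ℝ) ^ (-1 : ℝ) ≤ (n : ℝ) ^ (-(1 - δ)) :=
      Real.rpow_le_rpow_of_exponent_le hn1 (by linarith)
    rw [Real.rpow_neg_one] at h5
    calc 2 / (n : ℝ) = 2 * (n : ℝ)⁻¹ * 1 := by ring
      _ ≤ _ := by gcongr
  calc _ ≤ _ := add_le_add h3 h4
    _ = _ := by ring

/-! ### Good draws -/

/-- Markov's inequality; two such events together stay within the `1/8` required by `pi_card_gt_le`.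
-/
theorem measure_sixteen_mul_lt_le {X : Type*} [MeasurableSpace X] [DiscreteMeasurableSpace X]
    (P : Measure X) (F : X → ℝ≥0∞) {v : ℝ≥0∞} (hv0 : v ≠ 0) (hv : v ≠ ⊤) (hF : ∫⁻ x, F x ∂P ≤ v) :
    P {x | 16 * v < F x} ≤ 1 / 16 := by
  have h1 := mul_meas_ge_le_lintegral (μ := P) (f := F) .of_discrete (16 * v)
  have h2 : v * (16 * P {x | 16 * v < F x}) ≤ v * 1 := by
    calc v * (16 * P {x | 16 * v < F x}) = 16 * v * P {x | 16 * v < F x} := by ring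
      _ ≤ 16 * v * P {x | 16 * v ≤ F x} := by
        gcongr
        exact fun h => h.le
      _ ≤ v * 1 := by rw [mul_one]; exact h1.trans hF
  have h3 := (ENNReal.mul_le_mul_iff_right hv0 hv).1 h2
  rw [ENNReal.le_div_iff_mul_le (by simp) (by simp), mul_comm]
  exact h3

/-- The draws for which the dual lattice contains too many frequencies of small weight. -/
def badDraws {d : ℕ} (α : ℝ) (γ : ℕ → ℝ) (s : ℝ) (T : ℝ≥0∞) : Set (ℕ × (Fin d → ℕ)) :=
  {x | T < ∑' k, (dualSet x).indicator (fun k => eWeight α γ k ^ (-s)) k}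

section

variable {d : ℕ} {α : ℝ} {γ : ℕ → ℝ} {s a δ : ℝ} {T q S : ℝ≥0∞}

theorem lintegral_tsum_indicator_dualSet_le (P : Measure (ℕ × (Fin d → ℕ)))
    (hq : ∀ k : Fin d → ℤ, P {x | k ∈ dualSet x} ≤ q * eWeight α γ k ^ δ)
    (g : (Fin d → ℤ) → ℝ≥0∞) :
    ∫⁻ x, ∑' k, (dualSet x).indicator g k ∂P ≤ q * ∑' k, eWeight α γ k ^ δ * g k := by
  rw [lintegral_tsum fun k => (measurable_of_countable _).aemeasurable, ← ENNReal.tsum_mul_left]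
  refine ENNReal.tsum_le_tsum fun k => ?_
  have : ∀ x : ℕ × (Fin d → ℕ), (dualSet x).indicator g k =
      {x | k ∈ dualSet x}.indicator (fun _ => g k) x := fun x => by
    by_cases h : k ∈ dualSet x <;> simp [h]
  simp_rw [this]
  rw [lintegral_indicator_const .of_discrete, mul_comm, ← mul_assoc]
  gcongr
  exact hq k

theorem eWeight_rpow_add (hα : 0 < α) (hγ : ∀ j, 0 < γ j ∧ γ j ≤ 1) (k : Fin d → ℤ) (x y : ℝ) :
    eWeight α γ k ^ (x + y) = eWeight α γ k ^ x * eWeight α γ k ^ y :=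
  ENNReal.rpow_add _ _ (one_pos.trans_le (one_le_eWeight hα hγ k)).ne' (eWeight_ne_top _ _ _)

/-- The exponent `a + δ` makes up for the factor `r^δ` in the probabilities and leaves the summable
`r^(-a)`. -/
theorem measure_badDraws_le (hα : 0 < α) (hγ : ∀ j, 0 < γ j ∧ γ j ≤ 1)
    (P : Measure (ℕ × (Fin d → ℕ)))
    (hq : ∀ k : Fin d → ℤ, P {x | k ∈ dualSet x} ≤ q * eWeight α γ k ^ δ)
    (hS : ∑' k : Fin d → ℤ, eWeight α γ k ^ (-a) ≤ S)
    (hq0 : q ≠ 0) (hqt : q ≠ ⊤) (hS0 : S ≠ 0) (hSt : S ≠ ⊤) :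
    P (badDraws α γ (a + δ) (16 * (q * S))) ≤ 1 / 16 := by
  refine measure_sixteen_mul_lt_le P _ (mul_ne_zero hq0 hS0) (ENNReal.mul_ne_top hqt hSt) ?_
  refine (lintegral_tsum_indicator_dualSet_le P hq _).trans ?_
  gcongr
  refine le_trans (le_of_eq (tsum_congr fun k => ?_)) hS
  rw [← eWeight_rpow_add hα hγ]
  congr 1
  ring

/-- One term of a nonnegative series is at most its sum: a good draw has no dual frequency of small
weight. -/
theorem eWeight_rpow_neg_le_of_notMem_badDraws {x : ℕ × (Fin d → ℕ)}
    (hx : x ∉ badDraws α γ s T) {k : Fin d → ℤ} (hk : k ∈ dualSet x) :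
    eWeight α γ k ^ (-s) ≤ T := by
  have h : _ ≤ T := not_lt.1 hx
  refine le_trans (le_of_eq ?_) ((ENNReal.le_tsum k).trans h)
  rw [Set.indicator_of_mem hk]

theorem eWeight_rpow_neg_le (hs : 0 < s) {k : Fin d → ℤ}
    (hk : eWeight α γ k ^ (-s) ≤ T) {b : ℝ} (hb : 0 ≤ b) :
    eWeight α γ k ^ (-b) ≤ T ^ (b / s) := by
  have : -b = -s * (b / s) := by field_simp
  rw [this, ENNReal.rpow_mul]
  exact ENNReal.rpow_le_rpow hk (by positivity)

theorem inv_rpow_two_eq (k : Fin d → ℤ) :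
    ((eWeight α γ k)⁻¹) ^ (2 : ℝ) = eWeight α γ k ^ (-2 : ℝ) := by
  rw [ENNReal.inv_rpow, ENNReal.rpow_neg]

/-- Split `r^(-2) = r^(-s) r^(-(2-s))` on the dual lattice: the first factor sums to at most `T`,
the second is pointwise at most `T^((2-s)/s)`. The root of the product is `T^(1/s)`. -/
theorem enorm_sub_latticeRule_le_of_notMem_badDraws (hα : 0 < α)
    (hγ : ∀ j, 0 < γ j ∧ γ j ≤ 1) (hs : 0 < s) (hs2 : s ≤ 2) (hT0 : T ≠ 0) (hT : T ≠ ⊤)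
    {x : ℕ × (Fin d → ℕ)} (hx : x ∉ badDraws α γ s T)
    {f : (Fin d → ℝ) → ℂ} (hf : f ∈ korobovBall d α γ) :
    ‖cubeIntegral f - latticeRule x.1 x.2 f‖ₑ ≤ T ^ (1 / s) := by
  have h1 : ∀ k, (dualSet x).indicator (fun k => ‖fourierCoef f k‖ₑ) k =
      (dualSet x).indicator 1 k * ‖fourierCoef f k‖ₑ := fun k => by
    by_cases h : k ∈ dualSet x <;> simp [h]
  refine (enorm_sub_latticeRule_le hf.1 x).trans ?_
  simp_rw [h1]
  refine (tsum_mul_enorm_fourierCoef_le hf hα hγ _).trans ?_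
  have h2 : ∑' k, ((dualSet x).indicator 1 k * (eWeight α γ k)⁻¹) ^ (2 : ℝ) ≤
      T * T ^ ((2 - s) / s) := by
    calc _ ≤ ∑' k, (dualSet x).indicator (fun k => eWeight α γ k ^ (-s)) k *
          T ^ ((2 - s) / s) := by
          refine ENNReal.tsum_le_tsum fun k => ?_
          by_cases h : k ∈ dualSet x
          · have h3 := eWeight_rpow_neg_le hs (eWeight_rpow_neg_le_of_notMem_badDraws hx h)
              (by linarith : 0 ≤ 2 - s)
            simp only [h, Set.indicator_of_mem, Pi.one_apply, one_mul]
            rw [inv_rpow_two_eq, show (-2 : ℝ) = -s + -(2 - s) by ring, eWeight_rpow_add hα hγ]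
            gcongr
          · simp [h]
      _ = (∑' k, (dualSet x).indicator (fun k => eWeight α γ k ^ (-s)) k) *
          T ^ ((2 - s) / s) := ENNReal.tsum_mul_right
      _ ≤ _ := by
        gcongr
        exact not_lt.1 hx
  refine (ENNReal.rpow_le_rpow h2 (by norm_num)).trans (le_of_eq ?_)
  nth_rw 1 [← ENNReal.rpow_one T]
  rw [← ENNReal.rpow_add _ _ hT0 hT, ← ENNReal.rpow_mul]
  congr 1
  field_simp
  ring

theorem enorm_sub_latticeRule_le_rpow_half (hα : 0 < α) (hγ : ∀ j, 0 < γ j ∧ γ j ≤ 1)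
    (ha : a ≤ 2) (hS : ∑' k : Fin d → ℤ, eWeight α γ k ^ (-a) ≤ S)
    (x : ℕ × (Fin d → ℕ)) {f : (Fin d → ℝ) → ℂ} (hf : f ∈ korobovBall d α γ) :
    ‖cubeIntegral f - latticeRule x.1 x.2 f‖ₑ ≤ S ^ (1 / 2 : ℝ) := by
  calc _ ≤ ∑' k, (dualSet x).indicator (fun k => ‖fourierCoef f k‖ₑ) k :=
        enorm_sub_latticeRule_le hf.1 x
    _ ≤ ∑' k, 1 * ‖fourierCoef f k‖ₑ := by
        refine ENNReal.tsum_le_tsum fun k => ?_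
        rw [one_mul]
        exact Set.indicator_le_self' (fun _ _ => zero_le) k
    _ ≤ _ := tsum_mul_enorm_fourierCoef_le hf hα hγ fun _ => 1
    _ ≤ _ := by
        refine ENNReal.rpow_le_rpow (le_trans (ENNReal.tsum_le_tsum fun k => ?_) hS) (by norm_num)
        rw [one_mul, inv_rpow_two_eq]
        exact ENNReal.rpow_le_rpow_of_exponent_le (one_le_eWeight hα hγ k) (by linarith)

theorem measure_lt_enorm_sub_latticeRule_le (hα : 0 < α) (hγ : ∀ j, 0 < γ j ∧ γ j ≤ 1)
    (P : Measure (ℕ × (Fin d → ℕ)))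
    (hq : ∀ k : Fin d → ℤ, P {x | k ∈ dualSet x} ≤ q * eWeight α γ k ^ δ)
    (hS : ∑' k : Fin d → ℤ, eWeight α γ k ^ (-a) ≤ S)
    (hq0 : q ≠ 0) (hqt : q ≠ ⊤) (hS0 : S ≠ 0) (hSt : S ≠ ⊤)
    (hs : 0 < a + δ) (ha : 0 ≤ 2 - 2 * δ - a)
    {f : (Fin d → ℝ) → ℂ} (hf : f ∈ korobovBall d α γ) :
    P {x | 16 * (q * (S * (16 * (q * S)) ^ ((2 - 2 * δ - a) / (a + δ))) ^ (1 / 2 : ℝ)) <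
      ‖cubeIntegral f - latticeRule x.1 x.2 f‖ₑ} ≤ 1 / 8 := by
  set T := 16 * (q * S) with hT
  set e := (2 - 2 * δ - a) / (a + δ) with he
  set V := q * (S * T ^ e) ^ (1 / 2 : ℝ) with hV
  have hT0 : T ≠ 0 := mul_ne_zero (by norm_num) (mul_ne_zero hq0 hS0)
  have hTt : T ≠ ⊤ := ENNReal.mul_ne_top (by norm_num) (ENNReal.mul_ne_top hqt hSt)
  have hTe0 : T ^ e ≠ 0 := (ENNReal.rpow_pos (pos_iff_ne_zero.2 hT0) hTt).ne'
  have hTet : T ^ e ≠ ⊤ := ENNReal.rpow_ne_top_of_nonneg (by positivity) hTt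
  have hVt : V ≠ ⊤ := ENNReal.mul_ne_top hqt
    (ENNReal.rpow_ne_top_of_nonneg (by norm_num) (ENNReal.mul_ne_top hSt hTet))
  have hV0 : V ≠ 0 := mul_ne_zero hq0 (ENNReal.rpow_pos
    (pos_iff_ne_zero.2 (mul_ne_zero hS0 hTe0)) (ENNReal.mul_ne_top hSt hTet)).ne'
  -- This set does not depend on the draw, yet contains the dual frequencies of every good draw, so
  -- the expectation over draws can be taken term by term.
  set A : Set (Fin d → ℤ) := {k | eWeight α γ k ^ (-(a + δ)) ≤ T} with hA
  have h1 : ∫⁻ x, ∑' k, (dualSet x).indicator (A.indicator fun k => ‖fourierCoef f k‖ₑ) k ∂P ≤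
      V := by
    refine (lintegral_tsum_indicator_dualSet_le P hq _).trans ?_
    rw [hV]
    gcongr
    have h2 : ∀ k, eWeight α γ k ^ δ * A.indicator (fun k => ‖fourierCoef f k‖ₑ) k =
        A.indicator (fun k => eWeight α γ k ^ δ) k * ‖fourierCoef f k‖ₑ := fun k => by
      by_cases h : k ∈ A <;> simp [h]
    simp_rw [h2]
    refine (tsum_mul_enorm_fourierCoef_le hf hα hγ _).trans
      (ENNReal.rpow_le_rpow ?_ (by norm_num))
    calc _ ≤ ∑' k : Fin d → ℤ, eWeight α γ k ^ (-a) * T ^ e := by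
          refine ENNReal.tsum_le_tsum fun k => ?_
          by_cases h : k ∈ A
          · have h3 := eWeight_rpow_neg_le hs h ha
            rw [Set.indicator_of_mem h, ENNReal.mul_rpow_of_nonneg _ _ (by norm_num),
              inv_rpow_two_eq, ← ENNReal.rpow_mul, ← eWeight_rpow_add hα hγ,
              show δ * 2 + -2 = -a + -(2 - 2 * δ - a) by ring, eWeight_rpow_add hα hγ]
            gcongr
          · simp [h]
      _ = (∑' k : Fin d → ℤ, eWeight α γ k ^ (-a)) * T ^ e := ENNReal.tsum_mul_right
      _ ≤ _ := by gcongr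
  have h2 := measure_sixteen_mul_lt_le P _ hV0 hVt h1
  have h3 := measure_badDraws_le hα hγ P hq hS hq0 hqt hS0 hSt
  refine (measure_mono fun x hx => ?_).trans ((measure_union_le
    (badDraws α γ (a + δ) T) _).trans ((add_le_add h3 h2).trans (le_of_eq ?_)))
  · by_contra hcon
    simp only [Set.mem_union, not_or] at hcon
    refine hcon.2 (lt_of_lt_of_le hx ((enorm_sub_latticeRule_le hf.1 x).trans ?_))
    refine ENNReal.tsum_le_tsum fun k => ?_
    by_cases hk : k ∈ dualSet x
    · have hkA : k ∈ A := eWeight_rpow_neg_le_of_notMem_badDraws hcon.1 hk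
      simp [hk, hkA]
    · simp [hk]
  · rw [← ENNReal.toReal_eq_toReal_iff' (by finiteness) (by finiteness),
      ENNReal.toReal_add (by finiteness) (by finiteness)]
    norm_num

/-! ### The errors of the median rule -/

/-- `badDraws` does not involve `f`, so a single exceptional event serves the whole unit ball. -/
theorem pi_detError_medianRule_le (hα : 0 < α) (hγ : ∀ j, 0 < γ j ∧ γ j ≤ 1)
    (P : Measure (ℕ × (Fin d → ℕ))) [IsProbabilityMeasure P]
    (hq : ∀ k : Fin d → ℤ, P {x | k ∈ dualSet x} ≤ q * eWeight α γ k ^ δ)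
    (hS : ∑' k : Fin d → ℤ, eWeight α γ k ^ (-a) ≤ S)
    (hq0 : q ≠ 0) (hqt : q ≠ ⊤) (hS0 : S ≠ 0) (hSt : S ≠ ⊤)
    (hs : 0 < a + δ) (hs2 : a + δ ≤ 2) (m : ℕ) :
    (Measure.pi fun _ : Fin (2 * m + 1) => P)
      {ω | 2 * (16 * (q * S)) ^ (1 / (a + δ)) < detError α γ (medianRule ω)} ≤ (1 / 2) ^ m := by
  classical
  set T := 16 * (q * S) with hT
  have hT0 : T ≠ 0 := mul_ne_zero (by norm_num) (mul_ne_zero hq0 hS0)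
  have hTt : T ≠ ⊤ := ENNReal.mul_ne_top (by norm_num) (ENNReal.mul_ne_top hqt hSt)
  refine (measure_mono fun ω hω => ?_).trans (pi_card_gt_le P m (badDraws α γ (a + δ) T)
    ((measure_badDraws_le hα hγ P hq hS hq0 hqt hS0 hSt).trans (by gcongr; norm_num))
    (fun x => x ∈ badDraws α γ (a + δ) T) fun _ h => h)
  by_contra hcon
  refine (not_le.2 hω) (iSup₂_le fun f hf => enorm_sub_complexMedian_le _ _ _ ?_)
  refine le_trans (Finset.card_le_card fun i hi => ?_) (not_lt.1 hcon)
  simp only [Finset.mem_filter, Finset.mem_univ, true_and] at hi ⊢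
  by_contra hbad
  exact (not_le.2 hi)
    (enorm_sub_latticeRule_le_of_notMem_badDraws hα hγ hs hs2 hT0 hTt hbad hf)

/-- The exceptional event `E` may depend on `f`, since the supremum is outside the expectation. On
`E` the bound valid for all draws is used. -/
theorem ranError_medianRule_le (hα : 0 < α) (hγ : ∀ j, 0 < γ j ∧ γ j ≤ 1)
    (P : Measure (ℕ × (Fin d → ℕ))) [IsProbabilityMeasure P]
    (hq : ∀ k : Fin d → ℤ, P {x | k ∈ dualSet x} ≤ q * eWeight α γ k ^ δ)
    (hS : ∑' k : Fin d → ℤ, eWeight α γ k ^ (-a) ≤ S)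
    (hq0 : q ≠ 0) (hqt : q ≠ ⊤) (hS0 : S ≠ 0) (hSt : S ≠ ⊤)
    (hs : 0 < a + δ) (ha : 0 ≤ 2 - 2 * δ - a) (ha2 : a ≤ 2) (m : ℕ) :
    ranError (Measure.pi fun _ : Fin (2 * m + 1) => P) α γ (fun ω => medianRule ω) ≤
      2 * (16 * (q * (S * (16 * (q * S)) ^ ((2 - 2 * δ - a) / (a + δ))) ^ (1 / 2 : ℝ))) +
        2 * S ^ (1 / 2 : ℝ) * (1 / 2) ^ m := by
  classical
  refine iSup₂_le fun f hf => ?_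
  set t := 16 * (q * (S * (16 * (q * S)) ^ ((2 - 2 * δ - a) / (a + δ))) ^ (1 / 2 : ℝ)) with ht
  have hB := measure_lt_enorm_sub_latticeRule_le hα hγ P hq hS hq0 hqt hS0 hSt hs ha hf
  set E : Set (Fin (2 * m + 1) → ℕ × (Fin d → ℕ)) := {ω | m < (Finset.univ.filter fun i =>
    t < ‖cubeIntegral f - latticeRule (ω i).1 (ω i).2 f‖ₑ).card} with hE
  have hEm := pi_card_gt_le P m _ hB
    (fun x => t < ‖cubeIntegral f - latticeRule x.1 x.2 f‖ₑ) fun _ h => h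
  calc _ ≤ ∫⁻ ω, (2 * t + E.indicator (fun _ => 2 * S ^ (1 / 2 : ℝ)) ω)
        ∂(Measure.pi fun _ : Fin (2 * m + 1) => P) := by
        refine lintegral_mono fun ω => ?_
        by_cases hω : ω ∈ E
        · rw [Set.indicator_of_mem hω]
          refine le_trans ?_ le_add_self
          refine enorm_sub_complexMedian_le _ _ _ (le_of_eq_of_le ?_ (Nat.zero_le m))
          rw [Finset.card_eq_zero, Finset.filter_eq_empty_iff]
          exact fun i _ => not_lt.2 (enorm_sub_latticeRule_le_rpow_half hα hγ ha2 hS (ω i) hf)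
        · rw [Set.indicator_of_notMem hω, add_zero]
          exact enorm_sub_complexMedian_le _ _ _ (not_lt.1 hω)
    _ = 2 * t + 2 * S ^ (1 / 2 : ℝ) * (Measure.pi fun _ : Fin (2 * m + 1) => P) E := by
        rw [lintegral_add_left measurable_const, lintegral_indicator_const .of_discrete]
        simp
    _ ≤ _ := by gcongr

end

/-! ### Rates of convergence -/

/-- With `a = 1/α + δ` the two rates tend to exactly `α` and `α + 1/2` as `δ → 0`, and `1/α < 2`
leaves room for the other constraints. -/
theorem exists_exponents {α ε : ℝ} (hα : 1 / 2 < α) (hε : 0 < ε) :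
    ∃ a δ : ℝ, 0 < δ ∧ δ ≤ 1 / 2 ∧ 0 < a ∧ 1 < α * a ∧ a + δ ≤ 2 ∧ 0 ≤ 2 - 2 * δ - a ∧
      α - ε ≤ (1 - δ) * (1 / (a + δ)) ∧
      α + 1 / 2 - ε ≤ (1 - δ) * (1 + (2 - 2 * δ - a) / (a + δ) * (1 / 2)) := by
  have hα0 : 0 < α := by linarith
  have hinv : 1 / α < 2 := by
    rw [div_lt_iff₀ hα0]; linarith
  have hne : 1 / α + 0 + 0 ≠ 0 := by positivity
  have c1 : ContinuousAt (fun δ : ℝ => (1 - δ) * (1 / (1 / α + δ + δ))) 0 := by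
    fun_prop (disch := exact hne)
  have c2 : ContinuousAt (fun δ : ℝ =>
      (1 - δ) * (1 + (2 - 2 * δ - (1 / α + δ)) / (1 / α + δ + δ) * (1 / 2))) 0 := by
    fun_prop (disch := exact hne)
  have c3 : ContinuousAt (fun δ : ℝ => 1 / α + δ + 2 * δ) 0 := by fun_prop
  have e1 := c1.eventually_const_le (u := α - ε) (by
    have : (1 - 0) * (1 / (1 / α + 0 + 0)) = α := by field_simp; ring
    linarith)
  have e2 := c2.eventually_const_le (u := α + 1 / 2 - ε) (by
    have : (1 - 0) * (1 + (2 - 2 * 0 - (1 / α + 0)) / (1 / α + 0 + 0) * (1 / 2)) = α + 1 / 2 := by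
      field_simp; ring
    linarith)
  have e3 := c3.eventually_le_const (u := 2) (by linarith)
  have e4 : ∀ᶠ δ : ℝ in nhdsWithin 0 (Set.Ioi 0), δ ∈ Set.Ioc (0 : ℝ) (1 / 2) :=
    Ioc_mem_nhdsGT (by norm_num)
  obtain ⟨δ, ⟨h0, h1⟩, h2, h3, h4⟩ := (e4.and ((e1.and (e2.and e3)).filter_mono
    nhdsWithin_le_nhds)).exists
  refine ⟨1 / α + δ, δ, h0, h1, by positivity, ?_, by linarith, by linarith, h2, h3⟩
  rw [mul_add, mul_one_div_cancel hα0.ne']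
  have := mul_pos hα0 h0
  linarith

theorem isProbabilityMeasure_sampleLaw (h : ℕ → ℝ) (d : ℕ) {n : ℕ} (hn : 2 ≤ n) :
    IsProbabilityMeasure (sampleLaw h d n) := by
  have := isProbabilityMeasure_drawLaw d hn
  rw [sampleLaw]
  infer_instance

theorem detBound_of_measure_le (h : ℕ → ℝ) (d : ℕ) (α : ℝ) (γ : ℕ → ℝ) (ε C : ℝ) {n : ℕ}
    (hn : 2 ≤ n)
    (hle : sampleLaw h d n {ω | ENNReal.ofReal (C * (n : ℝ) ^ (-α + ε)) <
      detError α γ (medianRule ω)} ≤ ENNReal.ofReal ((n : ℝ) ^ (-h n))) :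
    DetBound h d α γ ε C n := by
  have := isProbabilityMeasure_sampleLaw h d hn
  have h1 : {ω : Fin (2 * halfReps h n + 1) → ℕ × (Fin d → ℕ) |
      detError α γ (medianRule ω) ≤ ENNReal.ofReal (C * (n : ℝ) ^ (-α + ε))} =
      {ω | ENNReal.ofReal (C * (n : ℝ) ^ (-α + ε)) < detError α γ (medianRule ω)}ᶜ := by
    ext ω; simp
  rw [DetBound, h1, probReal_compl_eq_one_sub .of_discrete]
  exact sub_le_sub_left (ENNReal.toReal_le_of_le_ofReal (by positivity) hle) _

/-- The order of quantifiers matters: `C` depends on `γ` and `d` only through `S`, so an `S` valid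
in all dimensions gives a dimension-free `C`. -/
theorem exists_bounds_of_tsum_le {α ε : ℝ} (hα : 1 / 2 < α) (hε : 0 < ε) :
    ∃ a : ℝ, 1 < α * a ∧ ∀ S : ℝ, 0 < S → ∃ C : ℝ, 0 < C ∧
      ∀ γ : ℕ → ℝ, (∀ j, 0 < γ j ∧ γ j ≤ 1) → ∀ d : ℕ,
        ∑' k : Fin d → ℤ, eWeight α γ k ^ (-a) ≤ ENNReal.ofReal S →
        ∀ (h : ℕ → ℝ) (n : ℕ), 2 ≤ n →
          (α + 1 / 2 ≤ h n → RanBound h d α γ ε C n) ∧ DetBound h d α γ ε C n := by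
  obtain ⟨a, δ, hδ, hδ', ha, haα, hs2, he, hdet, hran⟩ := exists_exponents hα hε
  have hα0 : 0 < α := by linarith
  obtain ⟨K, hK, hdual⟩ := exists_drawLaw_mem_dualSet_le hα0 hδ hδ'
  have hs : 0 < a + δ := by linarith
  refine ⟨a, haα, fun S hS => ?_⟩
  set e := (2 - 2 * δ - a) / (a + δ) with he_def
  -- The constants belong to the worst-case error, the randomized error off the failure event, and
  -- the failure event.
  set C₁ := 2 * (16 * (K * S)) ^ (1 / (a + δ)) with hC₁
  set C₂ := 2 * (16 * (K * (S * (16 * (K * S)) ^ e) ^ (1 / 2 : ℝ))) with hC₂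
  set C₃ := 2 * S ^ (1 / 2 : ℝ) with hC₃
  have hC₁0 : 0 < C₁ := by positivity
  have hC₂0 : 0 < C₂ := by positivity
  have hC₃0 : 0 < C₃ := by positivity
  refine ⟨C₁ + C₂ + C₃, by positivity, fun γ hγ d hSum h n hn => ?_⟩
  have hP := isProbabilityMeasure_drawLaw d hn
  have hn1 : (1 : ℝ) ≤ n := by exact_mod_cast (by omega : 1 ≤ n)
  have hn0 : (0 : ℝ) < n := by linarith
  set x : ℝ := (n : ℝ) ^ (-(1 - δ)) with hx
  have hx0 : 0 < x := by positivity
  have hq := hdual γ hγ d n hn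
  have hq0 : ENNReal.ofReal (K * x) ≠ 0 := by
    rw [Ne, ENNReal.ofReal_eq_zero, not_le]; positivity
  have hS0 : ENNReal.ofReal S ≠ 0 := by
    rw [Ne, ENNReal.ofReal_eq_zero, not_le]; exact hS
  have hT : 16 * (ENNReal.ofReal (K * x) * ENNReal.ofReal S) =
      ENNReal.ofReal (16 * (K * S) * x) := by
    rw [← ENNReal.ofReal_mul (by positivity), ← ENNReal.ofReal_ofNat 16,
      ← ENNReal.ofReal_mul (by positivity)]
    congr 1
    ring
  constructor
  · intro hhn
    have hmain := ranError_medianRule_le hα0 hγ (drawLaw d n) hq hSum hq0 ENNReal.ofReal_ne_top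
      hS0 ENNReal.ofReal_ne_top hs he (by linarith) (halfReps h n)
    refine hmain.trans ?_
    have hfail := half_pow_halfReps_le h hn
    have hpow : (n : ℝ) ^ (-h n) ≤ (n : ℝ) ^ (-α - 1 / 2 + ε) :=
      Real.rpow_le_rpow_of_exponent_le hn1 (by linarith)
    have hrate : x * (x ^ e) ^ (1 / 2 : ℝ) ≤ (n : ℝ) ^ (-α - 1 / 2 + ε) := by
      rw [hx, ← Real.rpow_mul hn0.le, ← Real.rpow_mul hn0.le, ← Real.rpow_add hn0]
      refine Real.rpow_le_rpow_of_exponent_le hn1 ?_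
      linarith
    have hmid : 2 * (16 * (ENNReal.ofReal (K * x) * (ENNReal.ofReal S *
        (16 * (ENNReal.ofReal (K * x) * ENNReal.ofReal S)) ^ e) ^ (1 / 2 : ℝ))) =
        ENNReal.ofReal (C₂ * (x * (x ^ e) ^ (1 / 2 : ℝ))) := by
      rw [hT, ENNReal.ofReal_rpow_of_pos (by positivity), ← ENNReal.ofReal_mul hS.le,
        ENNReal.ofReal_rpow_of_pos (by positivity), ← ENNReal.ofReal_mul (by positivity),
        ← ENNReal.ofReal_ofNat 16, ← ENNReal.ofReal_mul (by positivity),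
        ← ENNReal.ofReal_ofNat 2, ← ENNReal.ofReal_mul (by positivity)]
      congr 1
      rw [Real.mul_rpow (by positivity) hx0.le, ← mul_assoc S,
        Real.mul_rpow (by positivity) (by positivity), hC₂]
      ring
    have htail : 2 * ENNReal.ofReal S ^ (1 / 2 : ℝ) * (1 / 2) ^ halfReps h n ≤
        ENNReal.ofReal (C₃ * (n : ℝ) ^ (-h n)) := by
      rw [ENNReal.ofReal_mul hC₃0.le, hC₃, ENNReal.ofReal_mul (by norm_num),
        ENNReal.ofReal_rpow_of_pos hS, ENNReal.ofReal_ofNat]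
      gcongr
    refine (add_le_add hmid.le htail).trans ?_
    rw [← ENNReal.ofReal_add (by positivity) (by positivity)]
    refine ENNReal.ofReal_le_ofReal ?_
    have hy : 0 < (n : ℝ) ^ (-α - 1 / 2 + ε) := by positivity
    have h1 := mul_le_mul_of_nonneg_left hrate hC₂0.le
    have h2 := mul_le_mul_of_nonneg_left hpow hC₃0.le
    have h3 := mul_pos hC₁0 hy
    linarith
  · refine detBound_of_measure_le h d α γ ε _ hn ?_
    have hmain := pi_detError_medianRule_le hα0 hγ (drawLaw d n) hq hSum hq0
      ENNReal.ofReal_ne_top hS0 ENNReal.ofReal_ne_top hs hs2 (halfReps h n)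
    refine (measure_mono fun ω hω => ?_).trans (hmain.trans (half_pow_halfReps_le h hn))
    replace hω : ENNReal.ofReal ((C₁ + C₂ + C₃) * (n : ℝ) ^ (-α + ε)) <
      detError α γ (medianRule ω) := hω
    refine lt_of_le_of_lt ?_ hω
    rw [hT, ENNReal.ofReal_rpow_of_pos (by positivity), ← ENNReal.ofReal_ofNat 2,
      ← ENNReal.ofReal_mul (by positivity)]
    refine ENNReal.ofReal_le_ofReal ?_
    rw [Real.mul_rpow (by positivity) hx0.le, ← mul_assoc]
    have hrate : x ^ (1 / (a + δ)) ≤ (n : ℝ) ^ (-α + ε) := by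
      rw [hx, ← Real.rpow_mul hn0.le]
      refine Real.rpow_le_rpow_of_exponent_le hn1 ?_
      linarith
    calc C₁ * x ^ (1 / (a + δ)) ≤ C₁ * (n : ℝ) ^ (-α + ε) := by gcongr
      _ ≤ _ := by
        gcongr
        linarith

end MedianLattice
end

theorem theorem1 (α : ℝ) (hα : 1 / 2 < α) (γ : ℕ → ℝ) (hγ : ∀ j, 0 < γ j ∧ γ j ≤ 1)
    (ε : ℝ) (hε : 0 < ε) :
    (∀ d : ℕ, ∃ C : ℝ, 0 < C ∧
      ∀ h : ℕ → ℝ, (∀ n, 1 ≤ h n) → Filter.Tendsto h Filter.atTop Filter.atTop →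
        ∃ n₀ : ℕ, 0 < n₀ ∧
          (∀ n, n₀ ≤ n → MedianLattice.RanBound h d α γ ε C n) ∧
          (∀ n, 2 ≤ n → MedianLattice.DetBound h d α γ ε C n)) ∧
    ((Summable fun j => γ j ^ (1 / α)) →
      ∃ C : ℝ, 0 < C ∧
        ∀ h : ℕ → ℝ, (∀ n, 1 ≤ h n) → Filter.Tendsto h Filter.atTop Filter.atTop →
          ∃ n₀ : ℕ, 0 < n₀ ∧ ∀ d : ℕ,
            (∀ n, n₀ ≤ n → MedianLattice.RanBound h d α γ ε C n) ∧
            (∀ n, 2 ≤ n → MedianLattice.DetBound h d α γ ε C n)) := by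
  obtain ⟨a, ha, hbounds⟩ := MedianLattice.exists_bounds_of_tsum_le hα hε
  -- Only this threshold depends on `h`: beyond it the failure term `n^(-h(n))` is below the rate in
  -- (i).
  have threshold : ∀ h : ℕ → ℝ, Filter.Tendsto h Filter.atTop Filter.atTop →
      ∃ n₀ : ℕ, 0 < n₀ ∧ ∀ n, n₀ ≤ n → 2 ≤ n ∧ α + 1 / 2 ≤ h n := by
    intro h hh
    obtain ⟨N, hN⟩ := Filter.eventually_atTop.1 (hh.eventually_ge_atTop (α + 1 / 2))
    exact ⟨N + 2, by omega, fun n hn => ⟨by omega, hN n (by omega)⟩⟩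
  constructor
  · intro d
    obtain ⟨z, hz, hS⟩ := MedianLattice.exists_tsum_eWeight_rpow_le ha
    have hpos : 0 < ∏ j : Fin d, (1 + z * γ j ^ a) := Finset.prod_pos fun j _ => by
      have := (hγ j).1
      positivity
    obtain ⟨C, hC, hb⟩ := hbounds _ hpos
    refine ⟨C, hC, fun h _ hh => ?_⟩
    obtain ⟨n₀, hn₀, hn⟩ := threshold h hh
    have hb' := hb γ hγ d (hS γ hγ d) h
    exact ⟨n₀, hn₀, fun n hle => (hb' n (hn n hle).1).1 (hn n hle).2, fun n h2 => (hb' n h2).2⟩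
  · intro hsum
    obtain ⟨S, hS0, hS⟩ := MedianLattice.exists_tsum_eWeight_rpow_le_of_summable
      (by linarith : 0 < α) ha hγ hsum
    obtain ⟨C, hC, hb⟩ := hbounds S hS0
    refine ⟨C, hC, fun h _ hh => ?_⟩
    obtain ⟨n₀, hn₀, hn⟩ := threshold h hh
    refine ⟨n₀, hn₀, fun d => ?_⟩
    have hb' := hb γ hγ d (hS d) h
    exact ⟨fun n hle => (hb' n (hn n hle).1).1 (hn n hle).2, fun n h2 => (hb' n h2).2⟩
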